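/- Let $a,\mu,b\in\mathbb N$ with $0\le a<\mu<b$. For a summable nonnegative sequence ${\bf p}=(p_n)_{n\ge 0}$ put $\lambda_r=\sum_{0\le\ell\le b-1}p_\ell$, $\lambda_g=\sum_{\ell\ge a+1}p_\ell$ and $$\mathcal L[{\bf p}]_n=\lambda_r\big(\mathbf 1_{\{a\le n\}}p_{n+1}-\mathbf 1_{\{a+1\le n\}}p_n\big)+\lambda_g\big(\mathbf 1_{\{1\le n\le b\}}p_{n-1}-\mathbf 1_{\{n\le b-1\}}p_n\big).$$ Let $V_\mu$ be the set of probability mass functions on $\mathbb N$ with mean $\mu$, and let $\mathcal A=\{{\bf p}\in V_\mu:\sum_{n\ge0}2^np_n<\infty\}$. There is exactly one ${\bf p}^*\in V_\mu$ of the form $p^*_n=\bar r^{\,n-a}p^*_a$ for $a\le n\le b$, $p^*_n=0$ otherwise, with $\bar r>0$. Let ${\bf p}(t)=(p_n(t))_{n\ge0}$, $t\ge0$, be a classical solution of $\frac{\mathrm d}{\mathrm dt}{\bf p}(t)=\mathcal L[{\bf p}(t)]$, that is, for all $t\ge 0$ the $p_n(t)$ are nonnegative and summable in $n$, and each component is differentiable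 on $[0,\infty)$ (one-sidedly at $t=0$) and satisfies $p_n'(t)=\mathcal L[{\bf p}(t)]_n$; assume ${\bf p}(0)\in\mathcal A$. Put $$k_1=-\ln\Big(1-\frac{\mu}{b}\Big),\qquad k_2=\ln\Big(\max\Big\{\frac{2^{b+1}+2^a}{1-\mu/b},\ \sum_{n\ge0}2^np_n(0)\Big\}\Big),$$ $$\widetilde{\mathcal H}_{ab}[{\bf p}]=\sum_{n=0}^{a-1}p_n+\sum_{n=a}^{b}p_n\ln p_n+\sum_{n\ge b+1}p_n+k_1\sum_{n\ge b+1}n\,p_n+k_2\sum_{n=0}^{a-1}(a-n)\,p_n$$ (with $0\ln0=0$). Then $k_1>0$, $k_2>0$, ${\bf p}(t)\in V_\mu$ for all $t\ge0$, and: 1. $t\mapsto\widetilde{\mathcal H}_{ab}[{\bf p}(t)]$ is non-increasing on $[0,\infty)$. It is differentiable at every $t>0$ with $\frac{\mathrm d}{\mathrm dt}\widetilde{\mathcal H}_{ab}[{\bf p}(t)]\le0$, and at $t=0$ its right derivative exists in $[-\infty,0]$. 2. For each $t\ge0$, this derivative (the right derivative if $t=0$) equals $0$ if and only if ${\bf p}(t)={\bf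 p}^*$. 3. ${\bf p}(t)\to{\bf p}^*$ as $t\to\infty$ strongly in $\ell^q$ for every $1<q<\infty$. -/

import Mathlib

open Filter Topology Set
open scoped ENNReal

noncomputable section

namespace ThreeClassBDY

/-- Probability mass functions on `ℕ` with mean `μ`. -/
def V (μ : ℕ) : Set (ℕ → ℝ) :=
  {p | (∀ n, 0 ≤ p n) ∧ HasSum p 1 ∧ HasSum (fun n : ℕ => (n : ℝ) * p n) (μ : ℝ)}

/-- Admissible initial data: mean `μ` and finite exponential moment in base `2`. -/
def Admissible (μ : ℕ) : Set (ℕ → ℝ) :=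
  {p | p ∈ V μ ∧ Summable (fun n : ℕ => (2 : ℝ) ^ n * p n)}

/-- Proportion of receivers: `∑_{0 ≤ ℓ ≤ b - 1} p_ℓ`. -/
def rateR (b : ℕ) (p : ℕ → ℝ) : ℝ := ∑ l ∈ Finset.range b, p l

/-- Proportion of givers: `∑_{ℓ ≥ a + 1} p_ℓ`. -/
def rateG (a : ℕ) (p : ℕ → ℝ) : ℝ := ∑' l : ℕ, p (l + (a + 1))

/-- The right-hand side of the mean-field system. -/
def L (a b : ℕ) (p : ℕ → ℝ) (n : ℕ) : ℝ :=
  rateR b p * ((if a ≤ n then p (n + 1) else 0) - (if a + 1 ≤ n then p n else 0)) +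
    rateG a p *
      ((if 1 ≤ n ∧ n ≤ b then p (n - 1) else 0) - (if n + 1 ≤ b then p n else 0))

/-- Classical solutions on `[0, ∞)`: every component is differentiable in time (one-sidedly at
time `0`) and satisfies its equation; the components are nonnegative and summable (so that the
rates make sense). Conservation of mass and of the mean is not part of the definition. -/
structure IsClassicalSolution (a b : ℕ) (p : ℝ → ℕ → ℝ) : Prop where
  nonneg : ∀ t, 0 ≤ t → ∀ n, 0 ≤ p t n
  summable : ∀ t, 0 ≤ t → Summable (p t)
  ode : ∀ t, 0 ≤ t → ∀ n, HasDerivWithinAt (fun s => p s n) (L a b (p t) n) (Ici 0) t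

/-- `π` is a truncated geometric distribution `π_n = r^(n-a) π_a` supported on `{a, …, b}`, with
common ratio `r > 0`, total mass `1` and mean `μ`. -/
def IsTruncatedGeometric (a b μ : ℕ) (π : ℕ → ℝ) : Prop :=
  π ∈ V μ ∧ ∃ r : ℝ, 0 < r ∧
    ∀ n, π n = if a ≤ n ∧ n ≤ b then r ^ (n - a) * π a else 0

/-- The truncated entropy `∑_{n<a} p_n + ∑_{a≤n≤b} p_n log p_n + ∑_{n>b} p_n`. -/
def entropy (a b : ℕ) (p : ℕ → ℝ) : ℝ :=
  ∑ n ∈ Finset.range a, p n + ∑ n ∈ Finset.Icc a b, p n * Real.log (p n) +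
    ∑' n : ℕ, p (n + (b + 1))

/-- The modified entropy, with weights `k₁` and `k₂`. -/
def modEntropy (a b : ℕ) (k₁ k₂ : ℝ) (p : ℕ → ℝ) : ℝ :=
  entropy a b p + k₁ * ∑' n : ℕ, ((n + (b + 1) : ℕ) : ℝ) * p (n + (b + 1)) +
    k₂ * ∑ n ∈ Finset.range a, ((a : ℝ) - (n : ℝ)) * p n

/-- The weight `k₁ = - ln (1 - μ / b)`. -/
def weight₁ (b μ : ℕ) : ℝ := -Real.log (1 - (μ : ℝ) / (b : ℝ))

/-- The weight `k₂ = ln (max ((2^(b+1) + 2^a) / (1 - μ / b), ∑ 2^n p_n(0)))`. -/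
def weight₂ (a b μ : ℕ) (p₀ : ℕ → ℝ) : ℝ :=
  Real.log (max (((2 : ℝ) ^ (b + 1) + (2 : ℝ) ^ a) / (1 - (μ : ℝ) / (b : ℝ)))
    (∑' n : ℕ, (2 : ℝ) ^ n * p₀ n))

end ThreeClassBDY

end

/-!
The generator is in divergence form: `L_n = F_{n-1} - F_n`, where `F_n` (`flux`) is the net flux of
mass from site `n` to site `n + 1`, so every balance law is a summation by parts (`sum_mul_L`).
Sites below `a` only lose mass upwards and sites above `b` only lose mass downwards.

*Conservation laws.* Nothing is assumed on the tails of a solution at positive times. For `n > b`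
the functions `exp (C t) p_n(t)` are non-decreasing on bounded time intervals, so the terminal
distribution dominates earlier ones and no mass is exchanged with infinity (`mass_eq`). It follows
that the tails above `b` decrease in time (`tail_le`), and by stochastic dominance the exponential
moment at time `t` exceeds the initial one by at most `2 ^ b` (`exp_moment`). This yields a uniform
geometric bound on the components (`le_geometric`) and conservation of the mean (`mem_V`).

*Dissipation.* On `V μ` the mass and mean constraints turn the modified entropy into a function of
`p_0, …, p_b` (`modEntropy_eq`), so no series has to be differentiated. With `λ_r`, `λ_g` the rates,
`S` the mass below `a` and `T` the mass above `b`, its time derivative is at most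
`- ∑_{a ≤ n < b} F_n ^ 2 - (k₂ + log λ_g) λ_g S - (k₁ + log λ_r) λ_r T` (`entropyRate_le`). Markov's
inequality gives `k₁ + log λ_r > 0`, and a second moment estimate together with the bound on the
exponential moment gives `k₂ + log λ_g > 0` when `a ≥ 1` (`weight₂_add_log_pos`). The derivative
therefore vanishes only for distributions on `{a, …, b}` without flux, which are the truncated
geometric ones.

*Differentiability.* At positive times all sites of `{a, …, b}` are charged (`pos`), since an empty
site at an interior time forces its neighbours to be empty. At time `0` some of them may be empty.
If one of these gains mass, the right derivative is `-∞`. Otherwise all of `{a, …, b}` and the two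
adjacent sites are empty, the masses in `{a, …, b}` are `O(s ^ 2)` and contribute nothing, and the
derivative is `-(k₁ + k₂) λ_g λ_r < 0` (`exists_rightDeriv_zero`).

*Convergence.* The modified entropy, `∑_{n > b} n p_n` and `∑_{n < a} (a - n) p_n` are bounded below
and dissipate `∑ F_n ^ 2`, `T` and `S` respectively. These are uniformly continuous in time, so they
tend to `0` by Barbalat's lemma (`tendsto_zero_of_dissipation`). Hence every limit point of `p(t)` in
the compact space `[0, 1] ^ ℕ` is the unique truncated geometric distribution of mean `μ`
(`tendsto_apply`), and the geometric bound upgrades componentwise convergence to convergence in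
`ℓ¹`, hence in every `ℓ^q` with `1 < q < ∞`.
-/

namespace ThreeClassBDY

/-! ### Tails of summable sequences -/

/-- The tail `∑_{n ≥ N} p_n`. -/
noncomputable def tail (p : ℕ → ℝ) (N : ℕ) : ℝ := ∑' n : ℕ, p (n + N)

lemma sum_range_add_tail {p : ℕ → ℝ} (hp : Summable p) (N : ℕ) :
    ∑ n ∈ Finset.range N, p n + tail p N = ∑' n, p n :=
  hp.sum_add_tsum_nat_add N

lemma tail_nonneg {p : ℕ → ℝ} (hp : ∀ n, 0 ≤ p n) (N : ℕ) : 0 ≤ tail p N :=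
  tsum_nonneg fun _ => hp _

lemma tail_eq_add {p : ℕ → ℝ} (hp : Summable p) (N : ℕ) : tail p N = p N + tail p (N + 1) := by
  have h1 := sum_range_add_tail hp N
  have h2 := sum_range_add_tail hp (N + 1)
  rw [Finset.sum_range_succ] at h2
  linarith

lemma le_tail {p : ℕ → ℝ} (hp : Summable p) (h0 : ∀ n, 0 ≤ p n) {N n : ℕ} (h : N ≤ n) :
    p n ≤ tail p N := by
  have h1 : Summable fun k => p (k + N) := (summable_nat_add_iff N).2 hp
  have h2 := h1.le_tsum (n - N) (fun _ _ => h0 _)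
  rwa [Nat.sub_add_cancel h] at h2

/-- A monotone weight on a tail is at least its first value times the tail. -/
lemma mul_tail_le {p w : ℕ → ℝ} (hp : Summable p) (h0 : ∀ n, 0 ≤ p n) (hw : Monotone w)
    (hwp : Summable fun n => w n * p n) (N : ℕ) :
    w N * tail p N ≤ tail (fun n => w n * p n) N := by
  rw [tail, tail, ← tsum_mul_left]
  refine Summable.tsum_le_tsum (fun n => ?_) (((summable_nat_add_iff N).2 hp).mul_left _)
    ((summable_nat_add_iff (f := fun n => w n * p n) N).2 hwp)
  exact mul_le_mul_of_nonneg_right (hw (by omega)) (h0 _)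

/-- Stochastic dominance: if the tails of `u` are below those of `v`, then so is the sum against
every nonnegative monotone weight. -/
lemma weighted_sum_le_of_tail_le {u v w : ℕ → ℝ} (hu : Summable u) (hv : Summable v)
    (hu0 : ∀ n, 0 ≤ u n) (hv0 : ∀ n, 0 ≤ v n) (hw : Monotone w) (hw0 : ∀ n, 0 ≤ w n)
    (h : ∀ N, tail u N ≤ tail v N) (hwv : Summable fun n => w n * v n) :
    (Summable fun n => w n * u n) ∧ ∑' n, w n * u n ≤ ∑' n, w n * v n := by
  -- Both sides are compared through the sums against the truncated weight `min (w n) (w N)`.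
  have key : ∀ N, ∑ n ∈ Finset.range N, w n * u n + w N * tail u N ≤
      ∑ n ∈ Finset.range N, w n * v n + w N * tail v N := by
    intro N
    induction N with
    | zero => simpa using mul_le_mul_of_nonneg_left (h 0) (hw0 0)
    | succ N ih =>
      rw [tail_eq_add hu N, tail_eq_add hv N] at ih
      rw [Finset.sum_range_succ, Finset.sum_range_succ]
      have := mul_le_mul_of_nonneg_left (h (N + 1)) (sub_nonneg.2 (hw (Nat.le_succ N)))
      simp only [Nat.succ_eq_add_one] at this
      linarith
  have bd : ∀ N, ∑ n ∈ Finset.range N, w n * u n ≤ ∑' n, w n * v n := by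
    intro N
    have h1 := mul_nonneg (hw0 N) (tail_nonneg hu0 N)
    have h2 := mul_tail_le hv hv0 hw hwv N
    have h3 := sum_range_add_tail hwv N
    linarith [key N]
  have hs : Summable fun n => w n * u n :=
    summable_of_sum_range_le (fun n => mul_nonneg (hw0 n) (hu0 n)) bd
  exact ⟨hs, Real.tsum_le_of_sum_range_le (fun n => mul_nonneg (hw0 n) (hu0 n)) bd⟩

lemma tendsto_tail_zero {p : ℕ → ℝ} : Tendsto (tail p) atTop (𝓝 0) :=
  tendsto_sum_nat_add p

/-! ### Barbalat's lemma -/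

/-- If `G` is bounded below and decreases at least at rate `f ≥ 0`, where `f` is uniformly
continuous, then `f → 0`. -/
lemma tendsto_zero_of_dissipation {G G' f : ℝ → ℝ} {m : ℝ} (hG : ∀ t, 0 < t → m ≤ G t)
    (hd : ∀ t, 0 < t → HasDerivAt G (G' t) t) (hf : ∀ t, 0 < t → G' t ≤ -f t)
    (hf0 : ∀ t, 0 < t → 0 ≤ f t) (huc : UniformContinuousOn f (Ici 0)) :
    Tendsto f atTop (𝓝 0) := by
  -- Integrated form of the dissipation inequality.
  have drop : ∀ s t c : ℝ, 0 < s → s < t → (∀ x ∈ Ioo s t, c ≤ f x) →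
      c * (t - s) ≤ G s - G t := by
    intro s t c hs hst hc
    obtain ⟨x, hx, hxe⟩ := exists_hasDerivAt_eq_slope G G' hst
      (fun x hx => (hd x (hs.trans_le hx.1)).continuousAt.continuousWithinAt)
      (fun x hx => hd x (hs.trans hx.1))
    have h1 := hf x (hs.trans hx.1)
    have h2 := hc x hx
    have h3 : 0 < t - s := sub_pos.2 hst
    rw [eq_div_iff h3.ne'] at hxe
    nlinarith
  have anti : ∀ s t : ℝ, 0 < s → s ≤ t → G t ≤ G s := by
    intro s t hs hst
    rcases hst.eq_or_lt with rfl | h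
    · exact le_rfl
    · have := drop s t 0 hs h fun x hx => hf0 x (hs.trans hx.1)
      linarith
  -- `G` comes within any `η` of its infimum over positive times.
  have cauchy : ∀ η : ℝ, 0 < η → ∃ s, 0 < s ∧ ∀ t, s ≤ t → G s - η < G t := by
    intro η hη
    have hne : (G '' Ioi 0).Nonempty := ⟨G 1, 1, mem_Ioi.2 one_pos, rfl⟩
    have hbd : BddBelow (G '' Ioi 0) := ⟨m, by rintro _ ⟨t, ht, rfl⟩; exact hG t ht⟩
    obtain ⟨_, ⟨s, hs, rfl⟩, hlt⟩ := exists_lt_of_csInf_lt hne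
      (lt_add_of_pos_right (sInf (G '' Ioi 0)) hη)
    refine ⟨s, hs, fun t ht => ?_⟩
    have := csInf_le hbd ⟨t, lt_of_lt_of_le hs ht, rfl⟩
    linarith
  rw [Metric.tendsto_atTop]
  intro ε hε
  obtain ⟨δ, hδ, hδf⟩ := Metric.uniformContinuousOn_iff.1 huc (ε / 2) (half_pos hε)
  obtain ⟨s, hs, hsG⟩ := cauchy (ε / 2 * δ) (by positivity)
  refine ⟨s, fun t ht => ?_⟩
  have ht0 : 0 < t := hs.trans_le ht
  rw [Real.dist_eq, sub_zero, abs_of_nonneg (hf0 t ht0)]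
  by_contra! hcon
  have h1 := drop t (t + δ) (ε / 2) ht0 (by linarith) (by
    intro x hx
    have := hδf t (mem_Ici.2 ht0.le) x (mem_Ici.2 (ht0.trans hx.1).le)
      (by rw [dist_comm, Real.dist_eq, abs_lt]; constructor <;> linarith [hx.1, hx.2])
    rw [Real.dist_eq, abs_lt] at this
    linarith [this.2])
  have h2 := hsG (t + δ) (by linarith)
  have h3 := anti s t hs ht
  have : t + δ - t = δ := by ring
  rw [this] at h1
  linarith

/-! ### The truncated geometric equilibrium -/

/-- A sequence supported on `{a, …, b}` is summed over `k = n - a`. -/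
lemma hasSum_of_support {a b : ℕ} (hab : a ≤ b) {f : ℕ → ℝ}
    (hf : ∀ n, ¬ (a ≤ n ∧ n ≤ b) → f n = 0) :
    HasSum f (∑ k ∈ Finset.range (b - a + 1), f (a + k)) := by
  have h : ∑ k ∈ Finset.range (b - a + 1), f (a + k) = ∑ n ∈ Finset.Ico a (b + 1), f n := by
    rw [Finset.sum_Ico_eq_sum_range]
    congr 2
    omega
  rw [h]
  refine hasSum_sum_of_ne_finset_zero fun n hn => hf n ?_
  rw [Finset.mem_Ico] at hn
  omega

/-- The centred first moment `∑_k (a + k - μ) r ^ k` of the unnormalized geometric weights has a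
positive root. -/
lemma exists_ratio {a μ b : ℕ} (haμ : a < μ) (hμb : μ < b) :
    ∃ r : ℝ, 0 < r ∧
      ∑ k ∈ Finset.range (b - a + 1), (((a + k : ℕ) : ℝ) - μ) * r ^ k = 0 := by
  set g : ℝ → ℝ := fun r => ∑ k ∈ Finset.range (b - a + 1), (((a + k : ℕ) : ℝ) - μ) * r ^ k
    with hg
  have hcont : Continuous g := by fun_prop
  have h0 : g 0 < 0 := by
    have : g 0 = (a : ℝ) - μ := by
      simp only [hg]
      rw [Finset.sum_eq_single 0]
      · simp
      · intro k _ hk; simp [hk]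
      · simp
    rw [this, sub_neg]
    exact_mod_cast haμ
  obtain ⟨m, hm⟩ : ∃ m, b - a = m + 1 := ⟨b - a - 1, by omega⟩
  set R : ℝ := μ * (m + 1) + 1 with hR
  have hR1 : 1 ≤ R := by rw [hR]; nlinarith [Nat.cast_nonneg (α := ℝ) μ, Nat.cast_nonneg (α := ℝ) m]
  -- At `R` the top term exceeds the sum of the others.
  have hRpos : 0 < g R := by
    simp only [hg, hm]
    rw [Finset.sum_range_succ]
    have htop : (1 : ℝ) * R ^ (m + 1) ≤ (((a + (m + 1) : ℕ) : ℝ) - μ) * R ^ (m + 1) := by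
      refine mul_le_mul_of_nonneg_right ?_ (by positivity)
      have : (μ : ℝ) + 1 ≤ ((a + (m + 1) : ℕ) : ℝ) := by
        exact_mod_cast (by omega : μ + 1 ≤ a + (m + 1))
      linarith
    have hlow : ∑ k ∈ Finset.range (m + 1), (-(μ : ℝ) * R ^ m) ≤
        ∑ k ∈ Finset.range (m + 1), (((a + k : ℕ) : ℝ) - μ) * R ^ k := by
      refine Finset.sum_le_sum fun k hk => ?_
      have hk' : k ≤ m := by rw [Finset.mem_range] at hk; omega
      have h1 : R ^ k ≤ R ^ m := pow_le_pow_right₀ hR1 hk'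
      have h2 : 0 ≤ R ^ k := by positivity
      have h3 : (0 : ℝ) ≤ ((a + k : ℕ) : ℝ) := Nat.cast_nonneg _
      have h4 : (0 : ℝ) ≤ μ := Nat.cast_nonneg _
      nlinarith [mul_nonneg h3 h2, mul_le_mul_of_nonneg_left h1 h4]
    rw [Finset.sum_const, Finset.card_range, nsmul_eq_mul] at hlow
    have h5 : (0 : ℝ) < R ^ m := by positivity
    have h6 : R ^ (m + 1) = R ^ m * R := pow_succ _ _
    have h7 : ((m + 1 : ℕ) : ℝ) * (-(μ : ℝ) * R ^ m) = -(R - 1) * R ^ m := by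
      rw [hR]; push_cast; ring
    rw [h7] at hlow
    nlinarith
  obtain ⟨r, hr, hr0⟩ := intermediate_value_Icc (by linarith : (0 : ℝ) ≤ R) hcont.continuousOn
    ⟨h0.le, hRpos.le⟩
  refine ⟨r, lt_of_le_of_ne hr.1 ?_, hr0⟩
  rintro rfl
  exact absurd hr0 h0.ne

/-- The positive root is unique: dividing by `r ^ (μ - a)` makes every term of the centred first
moment monotone in `r`. -/
lemma ratio_unique {a μ b : ℕ} (haμ : a < μ) (hμb : μ < b) {r s : ℝ} (hr : 0 < r) (hrs : r < s)
    (h1 : ∑ k ∈ Finset.range (b - a + 1), (((a + k : ℕ) : ℝ) - μ) * r ^ k = 0)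
    (h2 : ∑ k ∈ Finset.range (b - a + 1), (((a + k : ℕ) : ℝ) - μ) * s ^ k = 0) : False := by
  set m := μ - a with hm
  have hs : 0 < s := hr.trans hrs
  have hpos : 0 < ∑ k ∈ Finset.range (b - a + 1),
      (((a + k : ℕ) : ℝ) - μ) * (s ^ k * r ^ m - r ^ k * s ^ m) := by
    refine Finset.sum_pos' (fun k _ => ?_) ⟨b - a, by simp, ?_⟩
    · rcases le_total m k with h | h
      · obtain ⟨j, rfl⟩ := Nat.exists_eq_add_of_le h
        have e : s ^ (m + j) * r ^ m - r ^ (m + j) * s ^ m = r ^ m * s ^ m * (s ^ j - r ^ j) := by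
          ring
        rw [e]
        have h3 : (μ : ℝ) ≤ ((a + (m + j) : ℕ) : ℝ) := by exact_mod_cast (by omega)
        have h4 : r ^ j ≤ s ^ j := pow_le_pow_left₀ hr.le hrs.le j
        exact mul_nonneg (by linarith) (mul_nonneg (by positivity) (by linarith))
      · obtain ⟨j, hj⟩ := Nat.exists_eq_add_of_le h
        have e : s ^ k * r ^ m - r ^ k * s ^ m = -(r ^ k * s ^ k * (s ^ j - r ^ j)) := by
          rw [hj]; ring
        rw [e]
        have h3 : ((a + k : ℕ) : ℝ) ≤ μ := by exact_mod_cast (by omega)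
        have h4 : r ^ j ≤ s ^ j := pow_le_pow_left₀ hr.le hrs.le j
        have h5 : 0 ≤ r ^ k * s ^ k * (s ^ j - r ^ j) := mul_nonneg (by positivity) (by linarith)
        nlinarith
    · obtain ⟨j, hj⟩ := Nat.exists_eq_add_of_le (by omega : m ≤ b - a)
      have hj0 : j ≠ 0 := by omega
      have e : s ^ (b - a) * r ^ m - r ^ (b - a) * s ^ m = r ^ m * s ^ m * (s ^ j - r ^ j) := by
        rw [hj]; ring
      rw [e]
      have h3 : (μ : ℝ) < ((a + (b - a) : ℕ) : ℝ) := by exact_mod_cast (by omega)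
      have h4 : r ^ j < s ^ j := pow_lt_pow_left₀ hrs hr.le hj0
      exact mul_pos (by linarith) (mul_pos (by positivity) (by linarith))
  have : ∑ k ∈ Finset.range (b - a + 1),
      (((a + k : ℕ) : ℝ) - μ) * (s ^ k * r ^ m - r ^ k * s ^ m) =
      (∑ k ∈ Finset.range (b - a + 1), (((a + k : ℕ) : ℝ) - μ) * s ^ k) * r ^ m -
      (∑ k ∈ Finset.range (b - a + 1), (((a + k : ℕ) : ℝ) - μ) * r ^ k) * s ^ m := by
    rw [Finset.sum_mul, Finset.sum_mul, ← Finset.sum_sub_distrib]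
    exact Finset.sum_congr rfl fun k _ => by ring
  rw [this, h1, h2] at hpos
  simp at hpos

lemma exists_isTruncatedGeometric {a μ b : ℕ} (haμ : a < μ) (hμb : μ < b) :
    ∃ π, IsTruncatedGeometric a b μ π := by
  obtain ⟨r, hr, hr0⟩ := exists_ratio haμ hμb
  have hab : a ≤ b := by omega
  set Z : ℝ := ∑ k ∈ Finset.range (b - a + 1), r ^ k with hZ
  have hZ0 : 0 < Z := Finset.sum_pos (fun k _ => by positivity) ⟨0, by simp⟩
  set π : ℕ → ℝ := fun n => if a ≤ n ∧ n ≤ b then r ^ (n - a) * Z⁻¹ else 0 with hπ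
  have hval : ∀ k ∈ Finset.range (b - a + 1), π (a + k) = r ^ k * Z⁻¹ := by
    intro k hk
    rw [Finset.mem_range] at hk
    have : a ≤ a + k ∧ a + k ≤ b := by omega
    simp [hπ, this]
  have hmass := hasSum_of_support hab (f := π) fun n hn => by simp only [hπ, if_neg hn]
  have hmean := hasSum_of_support hab (f := fun n => (n : ℝ) * π n)
    fun n hn => by simp only [hπ, if_neg hn, mul_zero]
  have e1 : ∑ k ∈ Finset.range (b - a + 1), π (a + k) = 1 := by
    rw [Finset.sum_congr rfl hval, ← Finset.sum_mul, ← hZ, mul_inv_cancel₀ hZ0.ne']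
  have e2 : ∑ k ∈ Finset.range (b - a + 1), ((a + k : ℕ) : ℝ) * π (a + k) = μ := by
    have : ∑ k ∈ Finset.range (b - a + 1), ((a + k : ℕ) : ℝ) * π (a + k) =
        (∑ k ∈ Finset.range (b - a + 1), (((a + k : ℕ) : ℝ) - μ) * r ^ k) * Z⁻¹ +
          μ * ∑ k ∈ Finset.range (b - a + 1), π (a + k) := by
      rw [Finset.sum_mul, Finset.mul_sum, ← Finset.sum_add_distrib]
      refine Finset.sum_congr rfl fun k hk => ?_
      rw [hval k hk]; ring
    rw [this, hr0, e1]; ring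
  rw [e1] at hmass
  rw [e2] at hmean
  refine ⟨π, ⟨fun n => ?_, hmass, hmean⟩, r, hr, fun n => ?_⟩
  · simp only [hπ]
    split_ifs
    · positivity
    · exact le_rfl
  · have : π a = Z⁻¹ := by simp [hπ, hab]
    rw [this]

/-- The two linear constraints of `V μ` in terms of the ratio `r` and of `π a`. -/
lemma truncatedGeometric_constraints {a μ b : ℕ} (hab : a ≤ b) {π : ℕ → ℝ} {r : ℝ}
    (hV : π ∈ V μ) (hπ : ∀ n, π n = if a ≤ n ∧ n ≤ b then r ^ (n - a) * π a else 0) :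
    (∑ k ∈ Finset.range (b - a + 1), r ^ k) * π a = 1 ∧
      ∑ k ∈ Finset.range (b - a + 1), (((a + k : ℕ) : ℝ) - μ) * r ^ k = 0 := by
  have hval : ∀ k ∈ Finset.range (b - a + 1), π (a + k) = r ^ k * π a := by
    intro k hk
    rw [Finset.mem_range] at hk
    have : a ≤ a + k ∧ a + k ≤ b := by omega
    rw [hπ, if_pos this, Nat.add_sub_cancel_left]
  have hmass := hasSum_of_support hab (f := π) fun n hn => by rw [hπ, if_neg hn]
  have hmean := hasSum_of_support hab (f := fun n => (n : ℝ) * π n)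
    fun n hn => by rw [hπ, if_neg hn, mul_zero]
  have e1 := hmass.unique hV.2.1
  have e2 := hmean.unique hV.2.2
  have e1' : (∑ k ∈ Finset.range (b - a + 1), r ^ k) * π a = 1 := by
    rw [← e1, Finset.sum_mul]
    exact (Finset.sum_congr rfl hval).symm
  refine ⟨e1', ?_⟩
  have : (∑ k ∈ Finset.range (b - a + 1), (((a + k : ℕ) : ℝ) - μ) * r ^ k) * π a = 0 := by
    have : (∑ k ∈ Finset.range (b - a + 1), (((a + k : ℕ) : ℝ) - μ) * r ^ k) * π a =
        ∑ k ∈ Finset.range (b - a + 1), ((a + k : ℕ) : ℝ) * π (a + k) -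
          μ * ∑ k ∈ Finset.range (b - a + 1), π (a + k) := by
      rw [Finset.sum_mul, Finset.mul_sum, ← Finset.sum_sub_distrib]
      refine Finset.sum_congr rfl fun k hk => ?_
      rw [hval k hk]; ring
    rw [this, e1, e2]; ring
  exact (mul_eq_zero.1 this).resolve_right (right_ne_zero_of_mul (e1'.symm ▸ one_ne_zero))

lemma IsTruncatedGeometric.unique {a μ b : ℕ} (haμ : a < μ) (hμb : μ < b) {π π' : ℕ → ℝ}
    (h : IsTruncatedGeometric a b μ π) (h' : IsTruncatedGeometric a b μ π') : π = π' := by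
  obtain ⟨hV, r, hr, hπ⟩ := h
  obtain ⟨hV', r', hr', hπ'⟩ := h'
  have hab : a ≤ b := by omega
  obtain ⟨m1, c1⟩ := truncatedGeometric_constraints hab hV hπ
  obtain ⟨m2, c2⟩ := truncatedGeometric_constraints hab hV' hπ'
  have hrr : r = r' := by
    rcases lt_trichotomy r r' with hlt | heq | hlt
    · exact (ratio_unique haμ hμb hr hlt c1 c2).elim
    · exact heq
    · exact (ratio_unique haμ hμb hr' hlt c2 c1).elim
  subst hrr
  have hZ : (∑ k ∈ Finset.range (b - a + 1), r ^ k) ≠ 0 :=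
    left_ne_zero_of_mul (m1.symm ▸ one_ne_zero)
  have ha : π a = π' a := mul_left_cancel₀ hZ (m1.trans m2.symm)
  funext n
  rw [hπ n, hπ' n, ha]

lemma IsTruncatedGeometric.pos {a μ b : ℕ} (hab : a ≤ b) {π : ℕ → ℝ}
    (h : IsTruncatedGeometric a b μ π) {n : ℕ} (han : a ≤ n) (hnb : n ≤ b) : 0 < π n := by
  obtain ⟨hV, r, hr, hπ⟩ := h
  have ha : π a ≠ 0 :=
    right_ne_zero_of_mul ((truncatedGeometric_constraints hab hV hπ).1.symm ▸ one_ne_zero)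
  have ha' : 0 < π a := lt_of_le_of_ne (hV.1 a) ha.symm
  rw [hπ n, if_pos ⟨han, hnb⟩]
  positivity

/-! ### Rates and fluxes -/

/-- The net flux of mass from site `n` to site `n + 1`. -/
noncomputable def flux (a b : ℕ) (p : ℕ → ℝ) (n : ℕ) : ℝ :=
  (if n + 1 ≤ b then rateG a p * p n else 0) - (if a ≤ n then rateR b p * p (n + 1) else 0)

lemma L_zero (a b : ℕ) (p : ℕ → ℝ) : L a b p 0 = -flux a b p 0 := by
  simp only [L, flux]
  split_ifs <;> first | omega | ring

lemma L_succ (a b : ℕ) (p : ℕ → ℝ) (n : ℕ) :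
    L a b p (n + 1) = flux a b p n - flux a b p (n + 1) := by
  simp only [L, flux, Nat.add_sub_cancel]
  split_ifs <;> first | omega | ring

/-- Summation by parts: the generator in divergence form. -/
lemma sum_mul_L (a b : ℕ) (p w : ℕ → ℝ) (N : ℕ) :
    ∑ n ∈ Finset.range (N + 1), w n * L a b p n =
      ∑ n ∈ Finset.range N, (w (n + 1) - w n) * flux a b p n - w N * flux a b p N := by
  induction N with
  | zero => simp [L_zero]
  | succ N ih => rw [Finset.sum_range_succ, ih, L_succ, Finset.sum_range_succ]; ring

lemma flux_of_lt {a b n : ℕ} (p : ℕ → ℝ) (hn : n < a) (hab : a < b) :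
    flux a b p n = rateG a p * p n := by
  rw [flux, if_pos (by omega), if_neg (by omega), sub_zero]

lemma flux_of_mem {a b n : ℕ} (p : ℕ → ℝ) (han : a ≤ n) (hnb : n < b) :
    flux a b p n = rateG a p * p n - rateR b p * p (n + 1) := by
  rw [flux, if_pos (by omega), if_pos han]

lemma flux_of_ge {a b n : ℕ} (p : ℕ → ℝ) (hn : b ≤ n) (hab : a < b) :
    flux a b p n = -(rateR b p * p (n + 1)) := by
  rw [flux, if_neg (by omega), if_pos (by omega), zero_sub]

section StaticBounds

variable {a μ b : ℕ} {q : ℕ → ℝ}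

lemma rateR_add_tail (hq : HasSum q 1) : rateR b q + tail q b = 1 := by
  rw [← hq.tsum_eq]; exact sum_range_add_tail hq.summable b

lemma sum_add_rateG (hq : HasSum q 1) : ∑ n ∈ Finset.range (a + 1), q n + rateG a q = 1 := by
  rw [← hq.tsum_eq]; exact sum_range_add_tail hq.summable (a + 1)

lemma le_one_of_mem (hq : q ∈ V μ) (n : ℕ) : q n ≤ 1 :=
  le_hasSum hq.2.1 n fun _ _ => hq.1 _

lemma rateR_nonneg (hq : ∀ n, 0 ≤ q n) : 0 ≤ rateR b q :=
  Finset.sum_nonneg fun _ _ => hq _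

lemma rateG_nonneg (hq : ∀ n, 0 ≤ q n) : 0 ≤ rateG a q :=
  tail_nonneg hq (a + 1)

lemma rateR_le_one (h0 : ∀ n, 0 ≤ q n) (hq : HasSum q 1) : rateR b q ≤ 1 := by
  linarith [rateR_add_tail (b := b) hq, tail_nonneg h0 b]

lemma rateG_le_one (hq : q ∈ V μ) : rateG a q ≤ 1 := by
  have := Finset.sum_nonneg fun n (_ : n ∈ Finset.range (a + 1)) => hq.1 n
  linarith [sum_add_rateG (a := a) hq.2.1]

/-- Since the mean exceeds `a`, there are givers. -/
lemma rateG_pos (hq : q ∈ V μ) (haμ : a < μ) : 0 < rateG a q := by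
  refine lt_of_le_of_ne (rateG_nonneg hq.1) fun h0 => ?_
  have hle : ∀ n : ℕ, (n : ℝ) * q n ≤ a * q n := by
    intro n
    rcases le_or_gt n a with h | h
    · exact mul_le_mul_of_nonneg_right (by exact_mod_cast h) (hq.1 n)
    · have h1 : q n ≤ rateG a q := le_tail hq.2.1.summable hq.1 h
      have h2 : q n = 0 := le_antisymm (h0 ▸ h1) (hq.1 n)
      simp [h2]
  have h1 := hasSum_le hle hq.2.2 (hq.2.1.mul_left (a : ℝ))
  rw [mul_one] at h1
  exact absurd haμ (not_lt.2 (by exact_mod_cast h1))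

/-- Markov's inequality, keeping the part of the mean carried by the receivers. -/
lemma markov_rateR (hq : q ∈ V μ) :
    ∑ n ∈ Finset.range b, (n : ℝ) * q n + b * (1 - rateR b q) ≤ μ := by
  have h1 := sum_range_add_tail hq.2.2.summable b
  rw [hq.2.2.tsum_eq] at h1
  have h2 := mul_tail_le hq.2.1.summable hq.1 (Nat.mono_cast (α := ℝ)) hq.2.2.summable b
  have h3 := rateR_add_tail (b := b) hq.2.1
  have h4 : 1 - rateR b q = tail q b := by linarith
  rw [h4]
  linarith

lemma le_rateR (hq : q ∈ V μ) (hb : 0 < b) : 1 - (μ : ℝ) / b ≤ rateR b q := by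
  have h1 := markov_rateR (b := b) hq
  have h2 : 0 ≤ ∑ n ∈ Finset.range b, (n : ℝ) * q n :=
    Finset.sum_nonneg fun n _ => mul_nonneg (Nat.cast_nonneg n) (hq.1 n)
  have h3 : (0 : ℝ) < b := by exact_mod_cast hb
  have h4 : 1 - rateR b q ≤ μ / b := by rw [le_div_iff₀ h3]; linarith
  linarith

/-- Markov's inequality is strict as soon as some site strictly between `0` and `b` is charged. -/
lemma lt_rateR (hq : q ∈ V μ) {n : ℕ} (hn : 0 < n) (hnb : n < b) (hqn : 0 < q n) :
    1 - (μ : ℝ) / b < rateR b q := by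
  have h1 := markov_rateR (b := b) hq
  have h2 : 0 < ∑ n ∈ Finset.range b, (n : ℝ) * q n :=
    Finset.sum_pos' (fun n _ => mul_nonneg (Nat.cast_nonneg n) (hq.1 n))
      ⟨n, Finset.mem_range.2 hnb, mul_pos (by exact_mod_cast hn) hqn⟩
  have h3 : (0 : ℝ) < b := by exact_mod_cast (hn.trans hnb)
  have h4 : 1 - rateR b q < μ / b := by rw [lt_div_iff₀ h3]; linarith
  linarith

lemma one_sub_div_pos (hμb : μ < b) : 0 < 1 - (μ : ℝ) / b := by
  have h3 : (0 : ℝ) < b := by exact_mod_cast (Nat.zero_le μ).trans_lt hμb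
  rw [sub_pos, div_lt_one h3]
  exact_mod_cast hμb

lemma rateR_pos (hq : q ∈ V μ) (hμb : μ < b) : 0 < rateR b q :=
  (one_sub_div_pos hμb).trans_le (le_rateR hq (by omega))

lemma eight_mul_sq_le (m : ℕ) : 8 * (m : ℝ) ^ 2 ≤ 9 * 2 ^ m := by
  have key : 8 * m ^ 2 ≤ 9 * 2 ^ m := by
    rcases Nat.lt_or_ge m 4 with h | h
    · interval_cases m <;> norm_num
    · induction m, h using Nat.le_induction with
      | base => norm_num
      | succ m hm ih => rw [pow_succ 2 m]; nlinarith
  exact_mod_cast key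

/-- A lower bound on the giver rate in terms of the exponential moment: the mean excess over `a` is
at least `1`, and `E[(X - a)⁺]² ≤ P(X > a) E[((X - a)⁺)²]`, where `(X - a)² ≤ (9/16) 2 ^ X` for
`X > a ≥ 1`. -/
lemma one_le_rateG_mul (hq : q ∈ V μ) (ha : 1 ≤ a) (haμ : a < μ)
    (hE : Summable fun n : ℕ => (2 : ℝ) ^ n * q n) :
    1 ≤ rateG a q * (9 / 16 * ∑' n : ℕ, (2 : ℝ) ^ n * q n) := by
  set E := ∑' n : ℕ, (2 : ℝ) ^ n * q n with hEdef
  have hg := rateG_pos hq haμ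
  set c := (rateG a q)⁻¹ with hc
  have hc0 : 0 < c := inv_pos.2 hg
  have hcg : c * rateG a q = 1 := inv_mul_cancel₀ hg.ne'
  have hind : HasSum (fun n => if n < a + 1 then 0 else q n) (rateG a q) := by
    have := (hasSum_nat_add_iff' (f := fun n => if n < a + 1 then 0 else q n)
      (g := rateG a q) (a + 1)).1
    refine this ?_
    rw [Finset.sum_eq_zero fun n hn => if_pos (Finset.mem_range.1 hn), sub_zero]
    have h2 : (fun n => (if n + (a + 1) < a + 1 then 0 else q (n + (a + 1)))) =
        fun n => q (n + (a + 1)) := by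
      funext n; rw [if_neg (by omega)]
    rw [h2]
    exact ((summable_nat_add_iff (a + 1)).2 hq.2.1.summable).hasSum
  -- Pointwise form of the weighted arithmetic-geometric mean inequality.
  have hpt : ∀ n : ℕ, 2 * ((n : ℝ) * q n - a * q n) ≤
      c * (if n < a + 1 then 0 else q n) + 9 / 16 * rateG a q * ((2 : ℝ) ^ n * q n) := by
    intro n
    have hqn := hq.1 n
    have hpow : (0 : ℝ) ≤ 9 / 16 * rateG a q * ((2 : ℝ) ^ n * q n) := by positivity
    split_ifs with h
    · have : (n : ℝ) ≤ a := by exact_mod_cast Nat.lt_succ_iff.1 h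
      nlinarith
    · obtain ⟨m, rfl⟩ := Nat.exists_eq_add_of_le (by omega : a ≤ n)
      have h1 := eight_mul_sq_le m
      have h2 : (2 : ℝ) ≤ 2 ^ a := by
        calc (2 : ℝ) = 2 ^ 1 := (pow_one 2).symm
          _ ≤ 2 ^ a := pow_le_pow_right₀ one_le_two ha
      have h3 : (m : ℝ) ^ 2 ≤ 9 / 16 * 2 ^ (a + m) := by
        rw [pow_add]
        nlinarith [mul_le_mul_of_nonneg_right h2 (by positivity : (0 : ℝ) ≤ 2 ^ m)]
      have h4 : 2 * (m : ℝ) ≤ c + rateG a q * (m : ℝ) ^ 2 := by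
        have h5 : 0 ≤ c * (1 - rateG a q * m) ^ 2 := by positivity
        have h6 : c * (1 - rateG a q * m) ^ 2 =
          c - 2 * (c * rateG a q) * m + (c * rateG a q) * rateG a q * m ^ 2 := by ring
        rw [h6, hcg] at h5
        linarith
      have h7 : 2 * (m : ℝ) ≤ c + 9 / 16 * rateG a q * 2 ^ (a + m) := by
        nlinarith [mul_le_mul_of_nonneg_left h3 hg.le]
      have h8 := mul_le_mul_of_nonneg_right h7 hqn
      push_cast
      linarith
  have hsum := hasSum_le hpt ((hq.2.2.sub (hq.2.1.mul_left (a : ℝ))).mul_left 2)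
    ((hind.mul_left c).add (hE.hasSum.mul_left (9 / 16 * rateG a q)))
  rw [hcg, ← hEdef] at hsum
  have : (a : ℝ) + 1 ≤ μ := by exact_mod_cast haμ
  linarith

/-! ### Entropy dissipation for a fixed distribution -/

/-- The derivative of the modified entropy with respect to the mass at site `n ≤ b`, once the sums
over `n > b` have been eliminated with the mass and mean constraints. -/
noncomputable def potential (a : ℕ) (k₁ k₂ : ℝ) (q : ℕ → ℝ) (n : ℕ) : ℝ :=
  (if a ≤ n then Real.log (q n) else 0) - k₁ * n + k₂ * ((a - n : ℕ) : ℝ)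

/-- The rate of change of the modified entropy along the flow. -/
noncomputable def entropyRate (a b : ℕ) (k₁ k₂ : ℝ) (q : ℕ → ℝ) : ℝ :=
  ∑ n ∈ Finset.range (b + 1), potential a k₁ k₂ q n * L a b q n

/-- The total flux through the bulk, in terms of the masses outside `{a, …, b}`. -/
lemma sum_flux_Ico (hq : HasSum q 1) (hab : a < b) :
    ∑ n ∈ Finset.Ico a b, flux a b q n =
      rateR b q * tail q (b + 1) - rateG a q * ∑ n ∈ Finset.range a, q n := by
  have h1 : ∑ n ∈ Finset.Ico a b, flux a b q n =
      rateG a q * ∑ n ∈ Finset.Ico a b, q n - rateR b q * ∑ n ∈ Finset.Ico a b, q (n + 1) := by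
    rw [Finset.mul_sum, Finset.mul_sum, ← Finset.sum_sub_distrib]
    refine Finset.sum_congr rfl fun n hn => ?_
    rw [Finset.mem_Ico] at hn
    exact flux_of_mem q hn.1 hn.2
  have h2 : ∑ n ∈ Finset.range a, q n + ∑ n ∈ Finset.Ico a b, q n = rateR b q :=
    Finset.sum_range_add_sum_Ico _ hab.le
  have h3 : ∑ n ∈ Finset.Ico a b, q (n + 1) + tail q (b + 1) = rateG a q := by
    rw [Finset.sum_Ico_add']
    have h4 := Finset.sum_range_add_sum_Ico q (by omega : a + 1 ≤ b + 1)
    have h5 := sum_range_add_tail hq.summable (b + 1)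
    rw [hq.tsum_eq] at h5
    have h6 := sum_add_rateG (a := a) hq
    linarith
  have h2' : ∑ n ∈ Finset.Ico a b, q n = rateR b q - ∑ n ∈ Finset.range a, q n := by linarith
  have h3' : ∑ n ∈ Finset.Ico a b, q (n + 1) = rateG a q - tail q (b + 1) := by linarith
  rw [h1, h2', h3']
  ring

/-- For `x, y ∈ (0, 1]` the logarithm expands distances. -/
lemma sq_le_mul_log_sub_log {x y : ℝ} (hx : 0 < x) (hx1 : x ≤ 1) (hy : 0 < y) (hy1 : y ≤ 1) :
    (x - y) ^ 2 ≤ (x - y) * (Real.log x - Real.log y) := by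
  have main : ∀ {u v : ℝ}, 0 < u → 0 < v → v ≤ 1 → u ≤ v → v - u ≤ Real.log v - Real.log u := by
    intro u v hu hv hv1 huv
    have h1 := Real.one_sub_inv_le_log_of_pos (div_pos hv hu)
    rw [Real.log_div hv.ne' hu.ne', inv_div] at h1
    have h2 : 1 - u / v = (v - u) / v := by field_simp
    rw [h2] at h1
    have h3 : v - u ≤ (v - u) / v := by
      rw [le_div_iff₀ hv]; nlinarith
    linarith
  rcases le_total x y with h | h
  · nlinarith [main hx hy hy1 h]
  · nlinarith [main hy hx hx1 h]

/-- The entropy dissipation inequality: the bulk dissipates at least the squared fluxes, while the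
weights absorb the contributions of the masses below `a` and above `b`. -/
lemma entropyRate_le (hq : q ∈ V μ) (haμ : a < μ) (hμb : μ < b) {k₁ k₂ : ℝ} (hk₁ : 0 ≤ k₁)
    (hpos : ∀ n, a ≤ n → n ≤ b → 0 < q n) :
    entropyRate a b k₁ k₂ q ≤ -∑ n ∈ Finset.Ico a b, flux a b q n ^ 2
      - (k₂ + Real.log (rateG a q)) * (rateG a q * ∑ n ∈ Finset.range a, q n)
      - (k₁ + Real.log (rateR b q)) * (rateR b q * tail q (b + 1)) := by
  have hab : a < b := haμ.trans hμb
  have hg := rateG_pos hq haμ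
  have hr := rateR_pos hq hμb
  have hg1 := rateG_le_one (a := a) hq
  have hr1 := rateR_le_one (b := b) hq.1 hq.2.1
  have hlog : ∀ n, Real.log (q n) ≤ 0 := fun n =>
    Real.log_nonpos (hq.1 n) (le_one_of_mem hq n)
  set lg := Real.log (rateG a q) with hlg
  set lr := Real.log (rateR b q) with hlr
  have hlg0 : lg ≤ 0 := Real.log_nonpos hg.le hg1
  have hlr0 : lr ≤ 0 := Real.log_nonpos hr.le hr1
  rw [entropyRate, sum_mul_L, ← Finset.sum_range_add_sum_Ico _ hab.le]
  -- Outflow from the sites below `a`.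
  have hlow : ∑ n ∈ Finset.range a,
      (potential a k₁ k₂ q (n + 1) - potential a k₁ k₂ q n) * flux a b q n ≤
      -(k₁ + k₂) * (rateG a q * ∑ n ∈ Finset.range a, q n) := by
    rw [Finset.mul_sum, Finset.mul_sum]
    refine Finset.sum_le_sum fun n hn => ?_
    have hn' := Finset.mem_range.1 hn
    rw [flux_of_lt q hn' hab]
    refine mul_le_mul_of_nonneg_right ?_ (mul_nonneg hg.le (hq.1 n))
    have h1 : (if a ≤ n + 1 then Real.log (q (n + 1)) else 0) ≤ 0 := by
      split_ifs
      · exact hlog _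
      · exact le_rfl
    have h2 : ((a - n : ℕ) : ℝ) = ((a - (n + 1) : ℕ) : ℝ) + 1 := by
      exact_mod_cast (by omega : a - n = (a - (n + 1)) + 1)
    simp only [potential, if_neg (by omega : ¬ a ≤ n)]
    rw [h2]
    push_cast
    linarith
  -- Bulk dissipation.
  have hmid : ∑ n ∈ Finset.Ico a b,
      (potential a k₁ k₂ q (n + 1) - potential a k₁ k₂ q n) * flux a b q n ≤
      -∑ n ∈ Finset.Ico a b, flux a b q n ^ 2 +
        (lg - lr - k₁) * ∑ n ∈ Finset.Ico a b, flux a b q n := by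
    rw [Finset.mul_sum, ← Finset.sum_neg_distrib, ← Finset.sum_add_distrib]
    refine Finset.sum_le_sum fun n hn => ?_
    rw [Finset.mem_Ico] at hn
    have hx : 0 < q n := hpos n hn.1 hn.2.le
    have hy : 0 < q (n + 1) := hpos (n + 1) (by omega) (by omega)
    have h1 := sq_le_mul_log_sub_log (mul_pos hg hx)
      (mul_le_one₀ hg1 hx.le (le_one_of_mem hq n)) (mul_pos hr hy)
      (mul_le_one₀ hr1 hy.le (le_one_of_mem hq (n + 1)))
    rw [Real.log_mul hg.ne' hx.ne', Real.log_mul hr.ne' hy.ne', ← flux_of_mem q hn.1 hn.2,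
      ← hlg, ← hlr] at h1
    simp only [potential, if_pos hn.1, if_pos (by omega : a ≤ n + 1),
      Nat.sub_eq_zero_of_le hn.1, Nat.sub_eq_zero_of_le (by omega : a ≤ n + 1)]
    push_cast
    linarith
  -- Inflow from the sites above `b`.
  have hhigh : 0 ≤ potential a k₁ k₂ q b * flux a b q b := by
    rw [flux_of_ge q le_rfl hab]
    have h1 : potential a k₁ k₂ q b ≤ 0 := by
      simp only [potential, if_pos hab.le, Nat.sub_eq_zero_of_le hab.le]
      have h2 : 0 ≤ k₁ * b := by positivity
      push_cast
      linarith [hlog b]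
    have h3 : 0 ≤ rateR b q * q (b + 1) := mul_nonneg hr.le (hq.1 _)
    nlinarith
  rw [sum_flux_Ico hq.2.1 hab] at hmid
  have hS : 0 ≤ rateG a q * ∑ n ∈ Finset.range a, q n :=
    mul_nonneg hg.le (Finset.sum_nonneg fun n _ => hq.1 n)
  have hT : 0 ≤ rateR b q * tail q (b + 1) := mul_nonneg hr.le (tail_nonneg hq.1 _)
  nlinarith [mul_nonneg (neg_nonneg.2 hlr0) hS, mul_nonneg (neg_nonneg.2 hlg0) hT]

/-- Distributions charging only `{a, …, b}` with no flux through the bulk are truncated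
geometric. -/
lemma isTruncatedGeometric_of_flux_eq_zero (hq : q ∈ V μ) (haμ : a < μ) (hμb : μ < b)
    (hflux : ∀ n ∈ Finset.Ico a b, flux a b q n = 0) (hlow : ∀ n < a, q n = 0)
    (hhigh : ∀ n, b < n → q n = 0) : IsTruncatedGeometric a b μ q := by
  have hg := rateG_pos hq haμ
  have hr := rateR_pos hq hμb
  refine ⟨hq, rateG a q / rateR b q, div_pos hg hr, fun n => ?_⟩
  have hind : ∀ k, a + k ≤ b → q (a + k) = (rateG a q / rateR b q) ^ k * q a := by
    intro k
    induction k with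
    | zero => intro _; simp
    | succ k ih =>
      intro hk
      have h1 := hflux (a + k) (Finset.mem_Ico.2 ⟨by omega, by omega⟩)
      rw [flux_of_mem q (by omega) (by omega), ih (by omega)] at h1
      rw [← Nat.add_assoc, pow_succ]
      field_simp at h1 ⊢
      linarith
  split_ifs with h
  · have := hind (n - a) (by omega)
    rwa [Nat.add_sub_cancel' h.1] at this
  · rcases lt_or_ge n a with h1 | h1
    · exact hlow n h1
    · exact hhigh n (by omega)

/-- The truncated geometric distribution is stationary. -/
lemma IsTruncatedGeometric.L_eq_zero (h : IsTruncatedGeometric a b μ q) (hab : a < b) (n : ℕ) :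
    L a b q n = 0 := by
  obtain ⟨hV, r, hr, hπ⟩ := h
  have hlow : ∀ n < a, q n = 0 := fun n hn => by rw [hπ, if_neg (by omega)]
  have hhigh : ∀ n, b < n → q n = 0 := fun n hn => by rw [hπ, if_neg (by omega)]
  have hstep : ∀ n, a ≤ n → n < b → q (n + 1) = r * q n := by
    intro n h1 h2
    rw [hπ (n + 1), hπ n, if_pos (by omega), if_pos (by omega), Nat.succ_sub h1, pow_succ]
    ring
  have hS : ∑ n ∈ Finset.range a, q n = 0 :=
    Finset.sum_eq_zero fun n hn => hlow n (Finset.mem_range.1 hn)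
  have hT : tail q (b + 1) = 0 := by
    have : (fun n => q (n + (b + 1))) = fun _ => 0 := funext fun n => hhigh _ (by omega)
    rw [tail, this, tsum_zero]
  -- Detailed balance of the rates follows by summing `q (n + 1) = r * q n` over the bulk.
  have hrate : rateG a q = r * rateR b q := by
    have h2 : ∑ n ∈ Finset.range a, q n + ∑ n ∈ Finset.Ico a b, q n = rateR b q :=
      Finset.sum_range_add_sum_Ico _ hab.le
    have h3 : ∑ n ∈ Finset.Ico a b, q (n + 1) = r * ∑ n ∈ Finset.Ico a b, q n := by
      rw [Finset.mul_sum]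
      exact Finset.sum_congr rfl fun n hn =>
        hstep n (Finset.mem_Ico.1 hn).1 (Finset.mem_Ico.1 hn).2
    rw [Finset.sum_Ico_add'] at h3
    have h4 := Finset.sum_range_add_sum_Ico q (by omega : a + 1 ≤ b + 1)
    have h5 := sum_range_add_tail hV.2.1.summable (b + 1)
    rw [hV.2.1.tsum_eq] at h5
    have h6 := sum_add_rateG (a := a) hV.2.1
    rw [hS, zero_add] at h2
    rw [← h2]
    linarith
  have hF : ∀ n, flux a b q n = 0 := by
    intro n
    rcases lt_or_ge n a with h1 | h1
    · rw [flux_of_lt q h1 hab, hlow n h1, mul_zero]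
    · rcases lt_or_ge n b with h2 | h2
      · rw [flux_of_mem q h1 h2, hstep n h1 h2, hrate]; ring
      · rw [flux_of_ge q h2 hab, hhigh (n + 1) (by omega), mul_zero, neg_zero]
  cases n with
  | zero => rw [L_zero, hF, neg_zero]
  | succ n => rw [L_succ, hF, hF, sub_zero]

/-- Sign and zero set of the dissipation, when the bulk is charged. -/
lemma entropyRate_nonpos_and_eq_zero_iff (hq : q ∈ V μ) (haμ : a < μ) (hμb : μ < b) {k₂ : ℝ}
    (hk₂ : 1 ≤ a → 0 < k₂ + Real.log (rateG a q))
    (hpos : ∀ n, a ≤ n → n ≤ b → 0 < q n) :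
    entropyRate a b (weight₁ b μ) k₂ q ≤ 0 ∧
      (entropyRate a b (weight₁ b μ) k₂ q = 0 ↔ IsTruncatedGeometric a b μ q) := by
  have hab : a < b := haμ.trans hμb
  have hg := rateG_pos hq haμ
  have hr := rateR_pos hq hμb
  have hc := one_sub_div_pos hμb
  have hk₁ : 0 ≤ weight₁ b μ := by
    rw [weight₁, neg_nonneg]
    have : (0 : ℝ) ≤ μ / b := by positivity
    exact Real.log_nonpos hc.le (by linarith)
  have hk₁r : 0 < weight₁ b μ + Real.log (rateR b q) := by
    have := Real.log_lt_log hc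
      (lt_rateR hq (by omega : 0 < a + 1) (by omega : a + 1 < b) (hpos _ (by omega) (by omega)))
    rw [weight₁]
    linarith
  have hle := entropyRate_le (k₂ := k₂) hq haμ hμb hk₁ hpos
  set S := ∑ n ∈ Finset.range a, q n with hSdef
  have hS0 : 0 ≤ S := Finset.sum_nonneg fun n _ => hq.1 n
  have hT0 : 0 ≤ tail q (b + 1) := tail_nonneg hq.1 _
  have hJ0 : 0 ≤ ∑ n ∈ Finset.Ico a b, flux a b q n ^ 2 := Finset.sum_nonneg fun n _ => sq_nonneg _
  have hA : 0 ≤ (k₂ + Real.log (rateG a q)) * (rateG a q * S) := by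
    rcases Nat.eq_zero_or_pos a with h | h
    · have : S = 0 := by rw [hSdef, h]; simp
      rw [this]; simp
    · exact mul_nonneg (hk₂ h).le (mul_nonneg hg.le hS0)
  have hB : 0 ≤ (weight₁ b μ + Real.log (rateR b q)) * (rateR b q * tail q (b + 1)) :=
    mul_nonneg hk₁r.le (mul_nonneg hr.le hT0)
  refine ⟨by linarith, fun h0 => ?_, fun h => ?_⟩
  · rw [h0] at hle
    have hJ : ∑ n ∈ Finset.Ico a b, flux a b q n ^ 2 = 0 := by linarith
    have hA' : (k₂ + Real.log (rateG a q)) * (rateG a q * S) = 0 := by linarith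
    have hB' : (weight₁ b μ + Real.log (rateR b q)) * (rateR b q * tail q (b + 1)) = 0 := by
      linarith
    have hT : tail q (b + 1) = 0 := by
      simpa [hk₁r.ne', hr.ne'] using hB'
    refine isTruncatedGeometric_of_flux_eq_zero hq haμ hμb (fun n hn => ?_) (fun n hn => ?_)
      fun n hn => ?_
    · exact pow_eq_zero_iff two_ne_zero |>.1
        ((Finset.sum_eq_zero_iff_of_nonneg fun n _ => sq_nonneg _).1 hJ n hn)
    · have hS : S = 0 := by simpa [(hk₂ (by omega)).ne', hg.ne'] using hA'
      exact (Finset.sum_eq_zero_iff_of_nonneg fun n _ => hq.1 n).1 hS n (Finset.mem_range.2 hn)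
    · exact le_antisymm (hT ▸ le_tail hq.2.1.summable hq.1 hn) (hq.1 n)
  · rw [entropyRate]
    exact Finset.sum_eq_zero fun n _ => by rw [h.L_eq_zero hab, mul_zero]

end StaticBounds

/-! ### Conservation laws and moments along solutions -/

lemma monotoneOn_of_hasDerivWithinAt {s : Set ℝ} (hs : Convex ℝ s) {f f' : ℝ → ℝ}
    (hf : ∀ t ∈ s, HasDerivWithinAt f (f' t) s t) (hf' : ∀ t ∈ s, 0 ≤ f' t) :
    MonotoneOn f s :=
  monotoneOn_of_hasDerivWithinAt_nonneg hs (fun t ht => (hf t ht).continuousWithinAt)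
    (fun t ht => (hf t (interior_subset ht)).mono interior_subset)
    fun t ht => hf' t (interior_subset ht)

section Solutions

variable {a μ b : ℕ} {p : ℝ → ℕ → ℝ}

lemma IsClassicalSolution.hasDerivWithinAt_sum (hp : IsClassicalSolution a b p) (w : ℕ → ℝ)
    (N : ℕ) {t : ℝ} (ht : 0 ≤ t) :
    HasDerivWithinAt (fun s => ∑ n ∈ Finset.range N, w n * p s n)
      (∑ n ∈ Finset.range N, w n * L a b (p t) n) (Ici 0) t :=
  HasDerivWithinAt.fun_sum fun n _ => (hp.ode t ht n).const_mul (w n)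

lemma IsClassicalSolution.continuousOn (hp : IsClassicalSolution a b p) (n : ℕ) :
    ContinuousOn (fun t => p t n) (Ici 0) :=
  fun t ht => (hp.ode t ht n).continuousWithinAt

/-- Above the level `b`, a truncated mass only changes through the inflow from the right. -/
lemma IsClassicalSolution.hasDerivWithinAt_mass (hp : IsClassicalSolution a b p) (hab : a < b)
    {N : ℕ} (hN : b ≤ N) {t : ℝ} (ht : 0 ≤ t) :
    HasDerivWithinAt (fun s => ∑ n ∈ Finset.range (N + 1), p s n)
      (rateR b (p t) * p t (N + 1)) (Ici 0) t := by
  have h := hp.hasDerivWithinAt_sum (fun _ => 1) (N + 1) ht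
  rw [sum_mul_L] at h
  simpa [flux_of_ge _ hN hab] using h

/-- Conservation of mass. No a priori control of the tails is needed: above `b` the functions
`exp (C t) * p_n(t)` are non-decreasing for a bound `C` on the receiver rate, so that the terminal
distribution dominates the earlier ones. -/
lemma IsClassicalSolution.mass_eq (hp : IsClassicalSolution a b p) (hab : a < b) {T : ℝ}
    (hT : 0 ≤ T) : ∑' n, p T n = ∑' n, p 0 n := by
  have hsub : Icc 0 T ⊆ Ici (0 : ℝ) := fun t ht => ht.1
  have hcont : ContinuousOn (fun t => rateR b (p t)) (Icc 0 T) :=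
    continuousOn_finsetSum _ fun n _ => (hp.continuousOn n).mono hsub
  obtain ⟨C, hC⟩ := isCompact_Icc.exists_bound_of_continuousOn hcont
  have hR0 : ∀ t ∈ Icc 0 T, 0 ≤ rateR b (p t) := fun t ht => rateR_nonneg (hp.nonneg t ht.1)
  have hRC : ∀ t ∈ Icc 0 T, rateR b (p t) ≤ C := fun t ht => (le_abs_self _).trans (hC t ht)
  have hC0 : 0 ≤ C := (norm_nonneg _).trans (hC 0 ⟨le_rfl, hT⟩)
  have hdom : ∀ n, b < n → ∀ t ∈ Icc 0 T, p t n ≤ Real.exp (C * T) * p T n := by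
    intro n hn t ht
    have hmono : MonotoneOn (fun s => Real.exp (C * s) * p s n) (Icc 0 T) := by
      refine monotoneOn_of_hasDerivWithinAt (convex_Icc 0 T)
        (f' := fun s => Real.exp (C * s) * C * p s n + Real.exp (C * s) * L a b (p s) n)
        (fun s hs => ?_) fun s hs => ?_
      · have h1 : HasDerivAt (fun s => Real.exp (C * s)) (Real.exp (C * s) * C) s := by
          simpa using ((hasDerivAt_id s).const_mul C).exp
        exact h1.hasDerivWithinAt.mul ((hp.ode s hs.1 n).mono hsub)
      · have hL : L a b (p s) n = rateR b (p s) * (p s (n + 1) - p s n) := by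
          rw [L, if_pos (by omega), if_pos (by omega), if_neg (by omega), if_neg (by omega)]
          ring
        have e : Real.exp (C * s) * C * p s n + Real.exp (C * s) * L a b (p s) n =
            Real.exp (C * s) * ((C - rateR b (p s)) * p s n + rateR b (p s) * p s (n + 1)) := by
          rw [hL]; ring
        rw [e]
        exact mul_nonneg (Real.exp_nonneg _) (add_nonneg
          (mul_nonneg (sub_nonneg.2 (hRC s hs)) (hp.nonneg s hs.1 n))
          (mul_nonneg (hR0 s hs) (hp.nonneg s hs.1 _)))
    have h1 := hmono ht ⟨hT, le_rfl⟩ ht.2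
    have h2 : 1 ≤ Real.exp (C * t) := Real.one_le_exp (mul_nonneg hC0 ht.1)
    have h3 := hp.nonneg t ht.1 n
    simp only at h1
    nlinarith
  have hbound : ∀ᶠ N in atTop, ‖∑ n ∈ Finset.range (N + 1), p T n -
      ∑ n ∈ Finset.range (N + 1), p 0 n‖ ≤ C * (Real.exp (C * T) * p T (N + 1)) * ‖T - 0‖ := by
    filter_upwards [eventually_ge_atTop b] with N hN
    refine (convex_Icc 0 T).norm_image_sub_le_of_norm_hasDerivWithin_le
      (f := fun s => ∑ n ∈ Finset.range (N + 1), p s n)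
      (fun s hs => (hp.hasDerivWithinAt_mass hab hN hs.1).mono hsub) (fun s hs => ?_)
      ⟨le_rfl, hT⟩ ⟨hT, le_rfl⟩
    have h3 := hp.nonneg s hs.1 (N + 1)
    rw [Real.norm_of_nonneg (mul_nonneg (hR0 s hs) h3)]
    exact mul_le_mul (hRC s hs) (hdom _ (by omega) s hs) h3 hC0
  have hlim : Tendsto (fun N => ‖∑ n ∈ Finset.range (N + 1), p T n -
      ∑ n ∈ Finset.range (N + 1), p 0 n‖) atTop (𝓝 ‖∑' n, p T n - ∑' n, p 0 n‖) := by
    have h1 := (hp.summable T hT).hasSum.tendsto_sum_nat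
    have h2 := (hp.summable 0 le_rfl).hasSum.tendsto_sum_nat
    exact (((tendsto_add_atTop_iff_nat 1).2 h1).sub ((tendsto_add_atTop_iff_nat 1).2 h2)).norm
  have hzero : Tendsto (fun N => C * (Real.exp (C * T) * p T (N + 1)) * ‖T - 0‖) atTop (𝓝 0) := by
    have h1 := (tendsto_add_atTop_iff_nat 1).2 (hp.summable T hT).tendsto_atTop_zero
    simpa using ((h1.const_mul (Real.exp (C * T))).const_mul C).mul_const ‖T - 0‖
  have := le_of_tendsto_of_tendsto hlim hzero hbound
  exact sub_eq_zero.1 (norm_le_zero_iff.1 this)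

lemma IsClassicalSolution.hasSum_one (hp : IsClassicalSolution a b p) (hab : a < b)
    (h0 : HasSum (p 0) 1) {t : ℝ} (ht : 0 ≤ t) : HasSum (p t) 1 := by
  rw [← h0.tsum_eq, ← hp.mass_eq hab ht]
  exact (hp.summable t ht).hasSum

/-- Above `b` individuals only move down, so the tails decrease in time. -/
lemma IsClassicalSolution.tail_le (hp : IsClassicalSolution a b p) (hab : a < b)
    {N : ℕ} (hN : b < N) {t : ℝ} (ht : 0 ≤ t) : tail (p t) N ≤ tail (p 0) N := by
  obtain ⟨N, rfl⟩ : ∃ M, N = M + 1 := ⟨N - 1, by omega⟩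
  have hmono : MonotoneOn (fun s => ∑ n ∈ Finset.range (N + 1), p s n) (Ici 0) :=
    monotoneOn_of_hasDerivWithinAt (convex_Ici 0)
      (fun s hs => hp.hasDerivWithinAt_mass hab (by omega) hs)
      fun s hs => mul_nonneg (rateR_nonneg (hp.nonneg s hs)) (hp.nonneg s hs _)
  have h1 := hmono self_mem_Ici ht ht
  have h2 := sum_range_add_tail (hp.summable t ht) (N + 1)
  have h3 := sum_range_add_tail (hp.summable 0 le_rfl) (N + 1)
  have h4 := hp.mass_eq hab ht
  simp only at h1
  linarith

/-- The exponential moment stays bounded: its part above `b` decreases by stochastic dominance, and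
its part up to `b` is at most `2 ^ b`. -/
lemma IsClassicalSolution.exp_moment (hp : IsClassicalSolution a b p) (hab : a < b)
    (h0 : HasSum (p 0) 1) (hE : Summable fun n : ℕ => (2 : ℝ) ^ n * p 0 n) {t : ℝ} (ht : 0 ≤ t) :
    (Summable fun n : ℕ => (2 : ℝ) ^ n * p t n) ∧
      ∑' n : ℕ, (2 : ℝ) ^ n * p t n ≤ 2 ^ b + ∑' n : ℕ, (2 : ℝ) ^ n * p 0 n := by
  have hs := hp.summable t ht
  have hn := hp.nonneg t ht
  have hn0 := hp.nonneg 0 le_rfl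
  have hshift : ∀ (q : ℕ → ℝ) N, tail (fun n => q (n + (b + 1))) N = tail q (N + (b + 1)) := by
    intro q N
    simp only [tail, add_assoc]
  obtain ⟨hs1, hle⟩ := weighted_sum_le_of_tail_le (u := fun n => p t (n + (b + 1)))
    (v := fun n => p 0 (n + (b + 1))) (w := fun n => (2 : ℝ) ^ (n + (b + 1)))
    ((summable_nat_add_iff _).2 hs) ((summable_nat_add_iff _).2 (hp.summable 0 le_rfl))
    (fun n => hn _) (fun n => hn0 _)
    (fun m n h => pow_le_pow_right₀ one_le_two (by omega)) (fun n => by positivity)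
    (fun N => by rw [hshift, hshift]; exact hp.tail_le hab (by omega) ht)
    ((summable_nat_add_iff (f := fun n : ℕ => (2 : ℝ) ^ n * p 0 n) (b + 1)).2 hE)
  have hs2 : Summable fun n : ℕ => (2 : ℝ) ^ n * p t n :=
    (summable_nat_add_iff (f := fun n : ℕ => (2 : ℝ) ^ n * p t n) (b + 1)).1 hs1
  refine ⟨hs2, ?_⟩
  have e1 := hs2.sum_add_tsum_nat_add (b + 1)
  have e2 := hE.sum_add_tsum_nat_add (b + 1)
  have h3 : 0 ≤ ∑ n ∈ Finset.range (b + 1), (2 : ℝ) ^ n * p 0 n :=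
    Finset.sum_nonneg fun n _ => mul_nonneg (by positivity) (hn0 n)
  have h4 : ∑ n ∈ Finset.range (b + 1), (2 : ℝ) ^ n * p t n ≤ 2 ^ b := by
    have h5 : ∑ n ∈ Finset.range (b + 1), (2 : ℝ) ^ n * p t n ≤
        ∑ n ∈ Finset.range (b + 1), (2 : ℝ) ^ b * p t n :=
      Finset.sum_le_sum fun n hn' => mul_le_mul_of_nonneg_right
        (pow_le_pow_right₀ one_le_two (by rw [Finset.mem_range] at hn'; omega)) (hn n)
    rw [← Finset.mul_sum] at h5
    have h6 : ∑ n ∈ Finset.range (b + 1), p t n ≤ 1 :=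
      sum_le_hasSum _ (fun n _ => hn n) (hp.hasSum_one hab h0 ht)
    exact h5.trans (mul_le_of_le_one_right (by positivity) h6)
  linarith

lemma sum_flux_range {q : ℕ → ℝ} (hq : HasSum q 1) (hab : a < b) {N : ℕ} (hN : b ≤ N) :
    ∑ n ∈ Finset.range N, flux a b q n = rateR b q * tail q (N + 1) := by
  induction N, hN using Nat.le_induction with
  | base =>
    rw [← Finset.sum_range_add_sum_Ico _ hab.le, sum_flux_Ico hq hab,
      Finset.sum_congr rfl fun n hn => flux_of_lt q (Finset.mem_range.1 hn) hab, ← Finset.mul_sum]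
    ring
  | succ N hN ih =>
    rw [Finset.sum_range_succ, ih, flux_of_ge q hN hab, tail_eq_add hq.summable (N + 1)]
    ring

/-- Time derivative of the first moment truncated at a level `N ≥ b`. -/
lemma IsClassicalSolution.hasDerivWithinAt_mean (hp : IsClassicalSolution a b p) (hab : a < b)
    (h0 : HasSum (p 0) 1) {N : ℕ} (hN : b ≤ N) {t : ℝ} (ht : 0 ≤ t) :
    HasDerivWithinAt (fun s => ∑ n ∈ Finset.range (N + 1), (n : ℝ) * p s n)
      (rateR b (p t) * (tail (p t) (N + 1) + N * p t (N + 1))) (Ici 0) t := by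
  have h := hp.hasDerivWithinAt_sum (fun n => (n : ℝ)) (N + 1) ht
  rw [sum_mul_L, flux_of_ge _ hN hab] at h
  simp only [Nat.cast_add, Nat.cast_one, add_sub_cancel_left, one_mul] at h
  rw [sum_flux_range (hp.hasSum_one hab h0 ht) hab hN] at h
  convert h using 1
  ring

/-- Conservation of the mean. -/
lemma IsClassicalSolution.mem_V (hp : IsClassicalSolution a b p) (hab : a < b)
    (h0 : p 0 ∈ Admissible μ) {t : ℝ} (ht : 0 ≤ t) : p t ∈ V μ := by
  obtain ⟨⟨hn0, hm0, hmean0⟩, hE0⟩ := h0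
  have hsum : Summable fun n : ℕ => (n : ℝ) * p t n := by
    refine Summable.of_nonneg_of_le (fun n => mul_nonneg n.cast_nonneg (hp.nonneg t ht n))
      (fun n => ?_) (hp.exp_moment hab hm0 hE0 ht).1
    refine mul_le_mul_of_nonneg_right ?_ (hp.nonneg t ht n)
    exact_mod_cast (Nat.lt_two_pow_self (n := n)).le
  refine ⟨hp.nonneg t ht, hp.hasSum_one hab hm0 ht, ?_⟩
  have hsub : Icc 0 t ⊆ Ici (0 : ℝ) := fun s hs => hs.1
  -- The time derivative of the truncated mean is controlled by the tails of the initial mean.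
  have hbound : ∀ᶠ N in atTop, ‖∑ n ∈ Finset.range (N + 1), (n : ℝ) * p t n -
      ∑ n ∈ Finset.range (N + 1), (n : ℝ) * p 0 n‖ ≤
        tail (fun n => (n : ℝ) * p 0 n) (N + 1) * ‖t - 0‖ := by
    filter_upwards [eventually_ge_atTop b] with N hN
    refine (convex_Icc 0 t).norm_image_sub_le_of_norm_hasDerivWithin_le
      (f := fun s => ∑ n ∈ Finset.range (N + 1), (n : ℝ) * p s n)
      (fun s hs => (hp.hasDerivWithinAt_mean hab hm0 hN hs.1).mono hsub) (fun s hs => ?_)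
      ⟨le_rfl, ht⟩ ⟨ht, le_rfl⟩
    have hs1 := hp.hasSum_one hab hm0 hs.1
    have h1 := hp.nonneg s hs.1
    have h2 := hp.tail_le hab (by omega : b < N + 1) hs.1
    have h3 : p s (N + 1) ≤ tail (p s) (N + 1) := le_tail hs1.summable h1 le_rfl
    have h4 := mul_tail_le hm0.summable hn0 (Nat.mono_cast (α := ℝ)) hmean0.summable (N + 1)
    have h5 : 0 ≤ tail (p s) (N + 1) + N * p s (N + 1) :=
      add_nonneg (tail_nonneg h1 _) (mul_nonneg N.cast_nonneg (h1 _))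
    have h6 : rateR b (p s) ≤ 1 := rateR_le_one h1 hs1
    have h7 : (0 : ℝ) ≤ N := N.cast_nonneg
    rw [Real.norm_of_nonneg (mul_nonneg (rateR_nonneg h1) h5)]
    push_cast at h4
    calc rateR b (p s) * (tail (p s) (N + 1) + N * p s (N + 1))
        ≤ tail (p s) (N + 1) + N * p s (N + 1) := mul_le_of_le_one_left h5 h6
      _ ≤ (N + 1) * tail (p 0) (N + 1) := by nlinarith
      _ ≤ _ := h4
  have hlim : Tendsto (fun N => ‖∑ n ∈ Finset.range (N + 1), (n : ℝ) * p t n -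
      ∑ n ∈ Finset.range (N + 1), (n : ℝ) * p 0 n‖) atTop
        (𝓝 ‖∑' n : ℕ, (n : ℝ) * p t n - μ‖) := by
    have h1 := hsum.hasSum.tendsto_sum_nat
    have h2 := hmean0.tendsto_sum_nat
    exact (((tendsto_add_atTop_iff_nat 1).2 h1).sub ((tendsto_add_atTop_iff_nat 1).2 h2)).norm
  have hzero : Tendsto (fun N => tail (fun n => (n : ℝ) * p 0 n) (N + 1) * ‖t - 0‖) atTop
      (𝓝 0) := by
    simpa using ((tendsto_add_atTop_iff_nat 1).2
      (tendsto_tail_zero (p := fun n => (n : ℝ) * p 0 n))).mul_const ‖t - 0‖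
  have := le_of_tendsto_of_tendsto hlim hzero hbound
  rw [← sub_eq_zero.1 (norm_le_zero_iff.1 this)]
  exact hsum.hasSum

/-- Uniform-in-time geometric decay. -/
lemma IsClassicalSolution.le_geometric (hp : IsClassicalSolution a b p) (hab : a < b)
    (h0 : p 0 ∈ Admissible μ) {t : ℝ} (ht : 0 ≤ t) (n : ℕ) :
    p t n ≤ (2 ^ b + ∑' n : ℕ, (2 : ℝ) ^ n * p 0 n) * (1 / 2) ^ n := by
  obtain ⟨hs, hle⟩ := hp.exp_moment hab h0.1.2.1 h0.2 ht
  have h1 := (hs.le_tsum n fun m _ => mul_nonneg (by positivity) (hp.nonneg t ht m)).trans hle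
  rw [one_div, inv_pow, ← div_eq_mul_inv, le_div_iff₀ (by positivity)]
  linarith

/-- The weight `k₂` beats the logarithm of the giver rate at all times. -/
lemma IsClassicalSolution.weight₂_add_log_pos (hp : IsClassicalSolution a b p)
    (haμ : a < μ) (hμb : μ < b) (h0 : p 0 ∈ Admissible μ) (ha : 1 ≤ a) {t : ℝ} (ht : 0 ≤ t) :
    0 < weight₂ a b μ (p 0) + Real.log (rateG a (p t)) := by
  have hab : a < b := haμ.trans hμb
  obtain ⟨hs, hle⟩ := hp.exp_moment hab h0.1.2.1 h0.2 ht
  have hV := hp.mem_V hab h0 ht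
  have hg := rateG_pos hV haμ
  have h1 := one_le_rateG_mul hV ha haμ hs
  rw [weight₂]
  set E0 := ∑' n : ℕ, (2 : ℝ) ^ n * p 0 n
  set A := ((2 : ℝ) ^ (b + 1) + (2 : ℝ) ^ a) / (1 - (μ : ℝ) / (b : ℝ)) with hA
  have hc := one_sub_div_pos hμb
  have hc1 : 1 - (μ : ℝ) / b ≤ 1 := by
    have : (0 : ℝ) ≤ μ / b := by positivity
    linarith
  have hpa : (0 : ℝ) < 2 ^ a := by positivity
  have hpb : (0 : ℝ) < 2 ^ b := by positivity
  have hA1 : (2 : ℝ) ^ (b + 1) ≤ A := by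
    rw [hA, le_div_iff₀ hc, pow_succ]
    nlinarith
  rw [pow_succ] at hA1
  have hX1 : 2 ^ b * 2 ≤ max A E0 := hA1.trans (le_max_left _ _)
  have hX2 : E0 ≤ max A E0 := le_max_right _ _
  have hX : 0 < max A E0 := by linarith
  -- `9 / 16 * (3 / 2) < 1` leaves room for the growth of the exponential moment by `2 ^ b`.
  have h2 : 9 / 16 * ∑' n : ℕ, (2 : ℝ) ^ n * p t n ≤ 27 / 32 * max A E0 := by linarith
  have h3 : 1 < max A E0 * rateG a (p t) := by
    nlinarith [mul_le_mul_of_nonneg_left h2 hg.le, mul_pos hX hg]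
  rw [← Real.log_mul hX.ne' hg.ne']
  exact Real.log_pos h3

lemma weight₁_pos (hμ : 0 < μ) (hμb : μ < b) : 0 < weight₁ b μ := by
  have hc := one_sub_div_pos hμb
  have h1 : (0 : ℝ) < μ := by exact_mod_cast hμ
  have h2 : (0 : ℝ) < b := by exact_mod_cast hμ.trans hμb
  have h3 : (0 : ℝ) < μ / b := div_pos h1 h2
  rw [weight₁, neg_pos]
  exact Real.log_neg hc (by linarith)

lemma weight₂_pos (hμb : μ < b) (p₀ : ℕ → ℝ) : 0 < weight₂ a b μ p₀ := by
  have hc := one_sub_div_pos hμb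
  have h1 : (0 : ℝ) ≤ μ / b := by positivity
  have h2 : (1 : ℝ) ≤ 2 ^ (b + 1) := one_le_pow₀ one_le_two
  have h3 : (0 : ℝ) < 2 ^ a := by positivity
  refine Real.log_pos (lt_of_lt_of_le ?_ (le_max_left _ _))
  rw [lt_div_iff₀ hc]
  linarith

/-! ### Positivity in the bulk -/

/-- At an empty site whose mass does not change, the neighbours feeding the site are empty. -/
lemma neighbours_eq_zero {q : ℕ → ℝ} (h0 : ∀ n, 0 ≤ q n) (hg : 0 < rateG a q)
    (hr : 0 < rateR b q) {n : ℕ} (hn : q n = 0) (hL : L a b q n ≤ 0) :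
    (a ≤ n → q (n + 1) = 0) ∧ (1 ≤ n → n ≤ b → q (n - 1) = 0) := by
  have e : L a b q n = rateR b q * (if a ≤ n then q (n + 1) else 0) +
      rateG a q * (if 1 ≤ n ∧ n ≤ b then q (n - 1) else 0) := by
    simp only [L, hn, ite_self, sub_zero]
  have hA : 0 ≤ rateR b q * (if a ≤ n then q (n + 1) else 0) := by
    refine mul_nonneg hr.le ?_
    split_ifs
    · exact h0 _
    · exact le_rfl
  have hB : 0 ≤ rateG a q * (if 1 ≤ n ∧ n ≤ b then q (n - 1) else 0) := by
    refine mul_nonneg hg.le ?_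
    split_ifs
    · exact h0 _
    · exact le_rfl
  constructor
  · intro h
    have : rateR b q * (if a ≤ n then q (n + 1) else 0) = 0 := by linarith
    rw [if_pos h] at this
    exact (mul_eq_zero.1 this).resolve_left hr.ne'
  · intro h h'
    have : rateG a q * (if 1 ≤ n ∧ n ≤ b then q (n - 1) else 0) = 0 := by linarith
    rw [if_pos ⟨h, h'⟩] at this
    exact (mul_eq_zero.1 this).resolve_left hg.ne'

/-- If no empty site of `{a, …, b}` gains mass and one of them is empty, then they all are, and so
are the two sites adjacent to `{a, …, b}`. -/
lemma bulk_eq_zero {q : ℕ → ℝ} (h0 : ∀ n, 0 ≤ q n) (hg : 0 < rateG a q) (hr : 0 < rateR b q)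
    (hL : ∀ n, a ≤ n → n ≤ b → q n = 0 → L a b q n ≤ 0) {m : ℕ} (ham : a ≤ m) (hmb : m ≤ b)
    (hm : q m = 0) : ∀ n, a ≤ n + 1 → n ≤ b + 1 → q n = 0 := by
  have up : ∀ k, m + k ≤ b + 1 → q (m + k) = 0 := by
    intro k
    induction k with
    | zero => exact fun _ => hm
    | succ k ih =>
      intro hk
      have hz := ih (by omega)
      exact (neighbours_eq_zero h0 hg hr hz (hL _ (by omega) (by omega) hz)).1 (by omega)
  have down : ∀ k, k ≤ m → a ≤ m - k + 1 → q (m - k) = 0 := by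
    intro k
    induction k with
    | zero => exact fun _ _ => hm
    | succ k ih =>
      intro hk hak
      have hz := ih (by omega) (by omega)
      exact (neighbours_eq_zero h0 hg hr hz (hL _ (by omega) (by omega) hz)).2
        (by omega) (by omega)
  intro n han hnb
  rcases le_total m n with h | h
  · have := up (n - m) (by omega)
    rwa [Nat.add_sub_cancel' h] at this
  · have := down (m - n) (by omega) (by omega)
    rwa [Nat.sub_sub_self h] at this

/-- Every site of `{a, …, b}` is charged at positive times. -/
lemma IsClassicalSolution.pos (hp : IsClassicalSolution a b p) (haμ : a < μ) (hμb : μ < b)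
    (h0 : p 0 ∈ Admissible μ) {t : ℝ} (ht : 0 < t) {n : ℕ} (han : a ≤ n) (hnb : n ≤ b) :
    0 < p t n := by
  have hV := hp.mem_V (haμ.trans hμb) h0 ht.le
  have hg := rateG_pos hV haμ
  have hr := rateR_pos hV hμb
  -- An interior zero is a minimum in time.
  have hL : ∀ m, p t m = 0 → L a b (p t) m ≤ 0 := by
    intro m hm
    have hmin : IsLocalMin (fun s => p s m) t := by
      filter_upwards [lt_mem_nhds ht] with s hs
      rw [hm]
      exact hp.nonneg s hs.le m
    exact (hmin.hasDerivAt_eq_zero ((hp.ode t ht.le m).hasDerivAt (Ici_mem_nhds ht))).le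
  by_contra hcon
  have hn : p t n = 0 := le_antisymm (not_lt.1 hcon) (hV.1 n)
  have hbulk := bulk_eq_zero hV.1 hg hr (fun m _ _ => hL m) han hnb hn
  have hup : ∀ k, p t (a + k) = 0 := by
    intro k
    induction k with
    | zero => exact hbulk a (by omega) (by omega)
    | succ k ih => exact (neighbours_eq_zero hV.1 hg hr ih (hL _ ih)).1 (by omega)
  have hz : rateG a (p t) = 0 := by
    have : (fun l => p t (l + (a + 1))) = fun _ => 0 := by
      funext l
      have := hup (l + 1)
      rwa [show a + (l + 1) = l + (a + 1) by ring] at this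
    rw [rateG, this, tsum_zero]
  exact hg.ne' hz

end Solutions

/-! ### The modified entropy along solutions -/

/-- The contribution of site `n ≤ b` to the modified entropy, once the sums over `n > b` have been
eliminated with the mass and mean constraints. -/
noncomputable def siteEntropy (a : ℕ) (k₁ k₂ : ℝ) (n : ℕ) (x : ℝ) : ℝ :=
  (if a ≤ n then x * Real.log x else x) + (k₂ * ((a - n : ℕ) : ℝ) - k₁ * n - 1) * x

section EntropyAlongSolutions

variable {a μ b : ℕ} {k₁ k₂ : ℝ}

/-- On `V μ` the modified entropy depends on finitely many components only. -/
lemma modEntropy_eq {q : ℕ → ℝ} (hq : q ∈ V μ) (hab : a < b) :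
    modEntropy a b k₁ k₂ q =
      ∑ n ∈ Finset.range (b + 1), siteEntropy a k₁ k₂ n (q n) + (1 + k₁ * μ) := by
  have h1 := hq.2.1.summable.sum_add_tsum_nat_add (b + 1)
  rw [hq.2.1.tsum_eq] at h1
  have h2 := hq.2.2.summable.sum_add_tsum_nat_add (b + 1)
  rw [hq.2.2.tsum_eq] at h2
  have h3 : ∑ n ∈ Finset.range (b + 1), (if a ≤ n then q n * Real.log (q n) else q n) =
      ∑ n ∈ Finset.range a, q n + ∑ n ∈ Finset.Icc a b, q n * Real.log (q n) := by
    rw [← Finset.sum_range_add_sum_Ico _ (by omega : a ≤ b + 1)]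
    congr 1
    · exact Finset.sum_congr rfl fun n hn => if_neg (by rw [Finset.mem_range] at hn; omega)
    · refine Finset.sum_congr (by ext; simp [Finset.mem_Ico, Finset.mem_Icc]) fun n hn => ?_
      exact if_pos (Finset.mem_Icc.1 hn).1
  have h4 : ∑ n ∈ Finset.range (b + 1), ((a - n : ℕ) : ℝ) * q n =
      ∑ n ∈ Finset.range a, ((a : ℝ) - n) * q n := by
    rw [← Finset.sum_range_add_sum_Ico _ (by omega : a ≤ b + 1)]
    have : ∑ n ∈ Finset.Ico a (b + 1), ((a - n : ℕ) : ℝ) * q n = 0 :=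
      Finset.sum_eq_zero fun n hn => by
        rw [Nat.sub_eq_zero_of_le (Finset.mem_Ico.1 hn).1]; simp
    rw [this, add_zero]
    exact Finset.sum_congr rfl fun n hn => by rw [Nat.cast_sub (Finset.mem_range.1 hn).le]
  have h5 : ∑ n ∈ Finset.range (b + 1), siteEntropy a k₁ k₂ n (q n) =
      ∑ n ∈ Finset.range (b + 1), (if a ≤ n then q n * Real.log (q n) else q n) +
        k₂ * ∑ n ∈ Finset.range (b + 1), ((a - n : ℕ) : ℝ) * q n -
        k₁ * ∑ n ∈ Finset.range (b + 1), (n : ℝ) * q n - ∑ n ∈ Finset.range (b + 1), q n := by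
    rw [Finset.mul_sum, Finset.mul_sum, ← Finset.sum_add_distrib, ← Finset.sum_sub_distrib,
      ← Finset.sum_sub_distrib]
    exact Finset.sum_congr rfl fun n _ => by rw [siteEntropy]; ring
  rw [h5, h3, h4, modEntropy, entropy]
  linear_combination h1 + k₁ * h2

lemma continuous_siteEntropy (n : ℕ) : Continuous (siteEntropy a k₁ k₂ n) := by
  unfold siteEntropy
  split_ifs
  · exact Real.continuous_mul_log.add (by fun_prop)
  · fun_prop

lemma hasDerivAt_siteEntropy (q : ℕ → ℝ) {n : ℕ} (h : a ≤ n → q n ≠ 0) :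
    HasDerivAt (siteEntropy a k₁ k₂ n) (potential a k₁ k₂ q n) (q n) := by
  unfold siteEntropy
  have h2 := (hasDerivAt_id (q n)).const_mul (k₂ * ((a - n : ℕ) : ℝ) - k₁ * n - 1)
  by_cases han : a ≤ n
  · simp only [if_pos han, potential]
    convert! (Real.hasDerivAt_mul_log (h han)).add h2 using 1
    ring
  · simp only [if_neg han, potential]
    convert! (hasDerivAt_id (q n)).add h2 using 1
    ring

variable {p : ℝ → ℕ → ℝ}

/-- Time derivative of the modified entropy while the bulk is charged. -/
lemma IsClassicalSolution.hasDerivWithinAt_modEntropy (hp : IsClassicalSolution a b p)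
    (hab : a < b) (h0 : p 0 ∈ Admissible μ) {t : ℝ} (ht : 0 ≤ t)
    (hpos : ∀ n, a ≤ n → n ≤ b → 0 < p t n) :
    HasDerivWithinAt (fun s => modEntropy a b k₁ k₂ (p s)) (entropyRate a b k₁ k₂ (p t))
      (Ici 0) t := by
  have h1 : HasDerivWithinAt (fun s => ∑ n ∈ Finset.range (b + 1), siteEntropy a k₁ k₂ n (p s n) +
      (1 + k₁ * μ)) (entropyRate a b k₁ k₂ (p t)) (Ici 0) t := by
    refine HasDerivWithinAt.add_const _ (HasDerivWithinAt.fun_sum fun n hn => ?_)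
    have hn' : n ≤ b := by rw [Finset.mem_range] at hn; omega
    exact (hasDerivAt_siteEntropy (p t) fun han => (hpos n han hn').ne').comp_hasDerivWithinAt t
      (hp.ode t ht n)
  exact h1.congr_of_mem (fun s hs => modEntropy_eq (hp.mem_V hab h0 hs) hab) ht

lemma IsClassicalSolution.continuousOn_modEntropy (hp : IsClassicalSolution a b p)
    (hab : a < b) (h0 : p 0 ∈ Admissible μ) :
    ContinuousOn (fun s => modEntropy a b k₁ k₂ (p s)) (Ici 0) := by
  refine ContinuousOn.congr (f := fun s => ∑ n ∈ Finset.range (b + 1),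
    siteEntropy a k₁ k₂ n (p s n) + (1 + k₁ * μ)) ?_
    fun s hs => modEntropy_eq (hp.mem_V hab h0 hs) hab
  exact (continuousOn_finsetSum _ fun n _ =>
    (continuous_siteEntropy n).comp_continuousOn (hp.continuousOn n)).add continuousOn_const

lemma IsClassicalSolution.hasDerivAt_modEntropy (hp : IsClassicalSolution a b p)
    (haμ : a < μ) (hμb : μ < b) (h0 : p 0 ∈ Admissible μ) {t : ℝ} (ht : 0 < t) :
    HasDerivAt (fun s => modEntropy a b k₁ k₂ (p s)) (entropyRate a b k₁ k₂ (p t)) t :=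
  (hp.hasDerivWithinAt_modEntropy (haμ.trans hμb) h0 ht.le
    fun _ han hnb => hp.pos haμ hμb h0 ht han hnb).hasDerivAt (Ici_mem_nhds ht)

/-! ### The right derivative at the initial time -/

lemma tendsto_slope_zero {f : ℝ → ℝ} {f' : ℝ} (hf : HasDerivWithinAt f f' (Ici 0) 0) :
    Tendsto (fun s => (f s - f 0) / s) (𝓝[>] 0) (𝓝 f') := by
  have h := hasDerivWithinAt_iff_tendsto_slope.1 hf
  rw [Ici_sdiff_left] at h
  refine h.congr fun s => ?_
  rw [slope_def_field, sub_zero]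

/-- A nonnegative quantity that vanishes quadratically has `x log x = o(s)`. -/
lemma tendsto_mul_log_div {f : ℝ → ℝ} {C : ℝ} (hf : ∀ s, 0 < s → 0 ≤ f s)
    (hC : ∀ s, 0 < s → f s ≤ C * s ^ 2) :
    Tendsto (fun s => f s * Real.log (f s) / s) (𝓝[>] 0) (𝓝 0) := by
  have hpos : ∀ᶠ s : ℝ in 𝓝[>] 0, 0 < s := eventually_mem_nhdsWithin
  have hf0 : Tendsto f (𝓝[>] 0) (𝓝 0) := by
    refine squeeze_zero' (hpos.mono fun s hs => hf s hs) (hpos.mono fun s hs => hC s hs) ?_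
    have : Tendsto (fun s : ℝ => C * s ^ 2) (𝓝 0) (𝓝 (C * 0 ^ 2)) :=
      (by fun_prop : Continuous fun s : ℝ => C * s ^ 2).tendsto 0
    simpa using this.mono_left nhdsWithin_le_nhds
  -- `x log x / s = 2 (√x / s) (√x log √x)`, a bounded factor times a vanishing one.
  have h1 : Tendsto (fun s => √(f s) * Real.log √(f s)) (𝓝[>] 0) (𝓝 0) := by
    have h2 : Continuous fun x : ℝ => √x * Real.log √x :=
      Real.continuous_mul_log.comp Real.continuous_sqrt
    have h3 := (h2.tendsto 0).comp hf0
    rw [Real.sqrt_zero, zero_mul] at h3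
    exact h3
  have h2 : Tendsto (fun s => 2 * √C * |√(f s) * Real.log √(f s)|) (𝓝[>] 0) (𝓝 0) := by
    simpa using h1.abs.const_mul (2 * √C)
  refine squeeze_zero_norm' (hpos.mono fun s hs => ?_) h2
  have h3 : f s = √(f s) * √(f s) := (Real.mul_self_sqrt (hf s hs)).symm
  have h4 : Real.log (f s) = 2 * Real.log √(f s) := by
    rw [Real.log_sqrt (hf s hs)]; ring
  have h5 : √(f s) ≤ √C * s := by
    have hC0 : 0 ≤ C := by
      have h6 := (hf s hs).trans (hC s hs)
      have h7 : 0 < s ^ 2 := by positivity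
      exact nonneg_of_mul_nonneg_left h6 h7
    rw [Real.sqrt_le_left (by positivity), mul_pow, Real.sq_sqrt hC0]
    exact hC s hs
  have e : f s * Real.log (f s) / s = 2 * (√(f s) / s) * (√(f s) * Real.log √(f s)) := by
    rw [h4]
    nth_rewrite 1 [h3]
    ring
  rw [e, norm_mul, Real.norm_eq_abs, Real.norm_eq_abs, abs_of_nonneg (by positivity)]
  refine mul_le_mul_of_nonneg_right ?_ (abs_nonneg _)
  have : √(f s) / s ≤ √C := by rw [div_le_iff₀ hs]; exact h5
  linarith

lemma abs_L_le {q : ℕ → ℝ} (hq : q ∈ V μ) (n : ℕ) : |L a b q n| ≤ 2 := by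
  have hr0 := rateR_nonneg (b := b) hq.1
  have hr1 := rateR_le_one (b := b) hq.1 hq.2.1
  have hg0 := rateG_nonneg (a := a) hq.1
  have hg1 := rateG_le_one (a := a) hq
  have hite : ∀ (c : Prop) [Decidable c] (m : ℕ),
      0 ≤ (if c then q m else 0) ∧ (if c then q m else 0) ≤ 1 := by
    intro c _ m
    split_ifs
    · exact ⟨hq.1 m, le_one_of_mem hq m⟩
    · exact ⟨le_rfl, zero_le_one⟩
  have main : ∀ {r x y : ℝ}, 0 ≤ r → r ≤ 1 → 0 ≤ x ∧ x ≤ 1 → 0 ≤ y ∧ y ≤ 1 →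
      |r * (x - y)| ≤ 1 := by
    rintro r x y h0 h1 ⟨hx0, hx1⟩ ⟨hy0, hy1⟩
    rw [abs_mul, abs_of_nonneg h0]
    exact mul_le_one₀ h1 (abs_nonneg _) (abs_le.2 ⟨by linarith, by linarith⟩)
  rw [L]
  have h1 := main hr0 hr1 (hite (a ≤ n) (n + 1)) (hite (a + 1 ≤ n) n)
  have h2 := main hg0 hg1 (hite (1 ≤ n ∧ n ≤ b) (n - 1)) (hite (n + 1 ≤ b) n)
  exact (abs_add_le _ _).trans (by linarith)

/-- A component of a solution that vanishes initially grows at most linearly, with a bound on its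
slope up to any given time. -/
lemma IsClassicalSolution.le_mul_of_eq_zero (hp : IsClassicalSolution a b p) {n : ℕ}
    (hn : p 0 n = 0) {T C : ℝ} (hT : 0 ≤ T) (hC : ∀ t ∈ Icc 0 T, L a b (p t) n ≤ C) :
    p T n ≤ C * T := by
  have hmono : MonotoneOn (fun t => C * t - p t n) (Icc 0 T) := by
    refine monotoneOn_of_hasDerivWithinAt (convex_Icc 0 T) (f' := fun t => C - L a b (p t) n)
      (fun t ht => ?_) fun t ht => sub_nonneg.2 (hC t ht)
    have h1 : HasDerivWithinAt (fun t : ℝ => C * t) C (Icc 0 T) t := by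
      simpa using ((hasDerivAt_id t).const_mul C).hasDerivWithinAt
    exact h1.sub ((hp.ode t ht.1 n).mono fun s hs => hs.1)
  have := hmono ⟨le_rfl, hT⟩ ⟨hT, le_rfl⟩ hT
  simp only [hn, mul_zero, sub_zero] at this
  linarith

/-- If a site and both its neighbours are initially empty then its mass grows at most
quadratically. -/
lemma IsClassicalSolution.le_sq_of_neighbours_eq_zero (hp : IsClassicalSolution a b p)
    (hab : a < b) (h0 : p 0 ∈ Admissible μ) {n : ℕ} (hn : p 0 n = 0) (hn1 : p 0 (n + 1) = 0)
    (hn2 : 1 ≤ n → p 0 (n - 1) = 0) {T : ℝ} (hT : 0 < T) : p T n ≤ 4 * T ^ 2 := by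
  have hlin : ∀ m, p 0 m = 0 → ∀ t ∈ Icc 0 T, p t m ≤ 2 * T := by
    intro m hm t ht
    have := hp.le_mul_of_eq_zero hm ht.1 (C := 2) fun s hs =>
      (le_abs_self _).trans (abs_L_le (hp.mem_V hab h0 hs.1) m)
    linarith [ht.2]
  have := hp.le_mul_of_eq_zero hn hT.le (C := 4 * T) fun t ht => by
    have hV := hp.mem_V hab h0 ht.1
    have hr0 := rateR_nonneg (b := b) hV.1
    have hr1 := rateR_le_one (b := b) hV.1 hV.2.1
    have hg0 := rateG_nonneg (a := a) hV.1
    have hg1 := rateG_le_one (a := a) hV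
    have hA : (if a ≤ n then p t (n + 1) else 0) - (if a + 1 ≤ n then p t n else 0) ≤ 2 * T := by
      have h1 := hlin _ hn1 t ht
      have h2 := hV.1 n
      split_ifs <;> linarith
    have hB : (if 1 ≤ n ∧ n ≤ b then p t (n - 1) else 0) - (if n + 1 ≤ b then p t n else 0) ≤
        2 * T := by
      have h2 := hV.1 n
      split_ifs with h3
      all_goals first
        | linarith
        | linarith [hlin _ (hn2 h3.1) t ht]
    have main : ∀ {r x : ℝ}, 0 ≤ r → r ≤ 1 → x ≤ 2 * T → r * x ≤ 2 * T := by
      intro r x h0 h1 hx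
      nlinarith [mul_le_mul_of_nonneg_left hx h0]
    rw [L]
    linarith [main hr0 hr1 hA, main hg0 hg1 hB]
  linarith

/-- The difference quotient of one site contribution is bounded above near time `0`, whatever the
initial mass of the site. -/
lemma IsClassicalSolution.siteEntropy_slope_le (hp : IsClassicalSolution a b p)
    (hab : a < b) (h0 : p 0 ∈ Admissible μ) (n : ℕ) :
    ∃ C : ℝ, ∀ᶠ s in 𝓝[>] (0 : ℝ),
      (siteEntropy a k₁ k₂ n (p s n) - siteEntropy a k₁ k₂ n (p 0 n)) / s ≤ C := by
  by_cases h : a ≤ n → p 0 n ≠ 0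
  · have h1 := tendsto_slope_zero
      ((hasDerivAt_siteEntropy (k₁ := k₁) (k₂ := k₂) (p 0) h).comp_hasDerivWithinAt 0
        (hp.ode 0 le_rfl n))
    exact ⟨_, h1.eventually_le_const (lt_add_one _)⟩
  · push Not at h
    have h1 := (tendsto_slope_zero (hp.ode 0 le_rfl n)).const_mul
      (k₂ * ((a - n : ℕ) : ℝ) - k₁ * n - 1)
    refine ⟨(k₂ * ((a - n : ℕ) : ℝ) - k₁ * n - 1) * L a b (p 0) n + 1, ?_⟩
    filter_upwards [h1.eventually_le_const (lt_add_one _), eventually_mem_nhdsWithin] with s hs hs0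
    refine le_trans ?_ hs
    have hV := hp.mem_V hab h0 (le_of_lt hs0)
    have h2 : p s n * Real.log (p s n) ≤ 0 :=
      mul_nonpos_of_nonneg_of_nonpos (hV.1 n) (Real.log_nonpos (hV.1 n) (le_one_of_mem hV n))
    simp only [siteEntropy, if_pos h.1, h.2, zero_mul, mul_zero, add_zero, sub_zero]
    rw [← mul_div_assoc]
    exact div_le_div_of_nonneg_right (by linarith) (le_of_lt hs0)

/-- An empty site of `{a, …, b}` that gains mass makes the entropy decrease infinitely fast. -/
lemma IsClassicalSolution.siteEntropy_slope_atBot (hp : IsClassicalSolution a b p) {n : ℕ}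
    (han : a ≤ n) (hn : p 0 n = 0) (hL : 0 < L a b (p 0) n) :
    Tendsto (fun s => (siteEntropy a k₁ k₂ n (p s n) - siteEntropy a k₁ k₂ n (p 0 n)) / s)
      (𝓝[>] 0) atBot := by
  have h1 := tendsto_slope_zero (hp.ode 0 le_rfl n)
  simp only [hn, sub_zero] at h1
  have hps : ∀ᶠ s in 𝓝[>] (0 : ℝ), 0 < p s n := by
    filter_upwards [h1.eventually (lt_mem_nhds hL), eventually_mem_nhdsWithin] with s hs hs0
    exact (div_pos_iff_of_pos_right hs0).1 hs
  have h2 : Tendsto (fun s => p s n) (𝓝[>] 0) (𝓝[>] 0) := by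
    refine tendsto_nhdsWithin_iff.2 ⟨?_, hps⟩
    have := (hp.ode 0 le_rfl n).continuousWithinAt.tendsto
    rw [hn] at this
    exact this.mono_left (nhdsWithin_mono _ Ioi_subset_Ici_self)
  have h3 : Tendsto (fun s => p s n / s * (Real.log (p s n) +
      (k₂ * ((a - n : ℕ) : ℝ) - k₁ * n - 1))) (𝓝[>] 0) atBot :=
    h1.pos_mul_atBot hL (tendsto_atBot_add_const_right _ _ (Real.tendsto_log_nhdsGT_zero.comp h2))
  refine h3.congr fun s => ?_
  simp only [siteEntropy, if_pos han, hn, zero_mul, mul_zero, add_zero, sub_zero]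
  ring

/-- When `{a, …, b}` is empty and gains no mass, the entropy is driven by the outer masses only. -/
lemma entropyRate_of_bulk_eq_zero {q : ℕ → ℝ} (hab : a < b)
    (hz : ∀ n, a ≤ n → n ≤ b + 1 → q n = 0) :
    entropyRate a b k₁ k₂ q = -(k₁ + k₂) * (rateG a q * rateR b q) := by
  have hR : rateR b q = ∑ n ∈ Finset.range a, q n := by
    have : ∑ n ∈ Finset.Ico a b, q n = 0 := Finset.sum_eq_zero fun n hn =>
      hz n (Finset.mem_Ico.1 hn).1 (by have := (Finset.mem_Ico.1 hn).2; omega)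
    rw [rateR, ← Finset.sum_range_add_sum_Ico _ hab.le, this, add_zero]
  rw [entropyRate, sum_mul_L, flux_of_ge q le_rfl hab, hz (b + 1) (by omega) le_rfl,
    ← Finset.sum_range_add_sum_Ico _ hab.le]
  have h1 : ∑ n ∈ Finset.Ico a b,
      (potential a k₁ k₂ q (n + 1) - potential a k₁ k₂ q n) * flux a b q n = 0 := by
    refine Finset.sum_eq_zero fun n hn => ?_
    rw [Finset.mem_Ico] at hn
    rw [flux_of_mem q hn.1 hn.2, hz n (by omega) (by omega), hz (n + 1) (by omega) (by omega)]
    simp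
  have h2 : ∑ n ∈ Finset.range a,
      (potential a k₁ k₂ q (n + 1) - potential a k₁ k₂ q n) * flux a b q n =
      -(k₁ + k₂) * (rateG a q * rateR b q) := by
    rw [hR, Finset.mul_sum, Finset.mul_sum]
    refine Finset.sum_congr rfl fun n hn => ?_
    have hn' := Finset.mem_range.1 hn
    rw [flux_of_lt q hn' hab]
    have h3 : (if a ≤ n + 1 then Real.log (q (n + 1)) else 0) = 0 := by
      split_ifs with h
      · rw [hz (n + 1) h (by omega), Real.log_zero]
      · rfl
    have h4 : ((a - n : ℕ) : ℝ) = ((a - (n + 1) : ℕ) : ℝ) + 1 := by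
      exact_mod_cast (by omega : a - n = (a - (n + 1)) + 1)
    simp only [potential, if_neg (by omega : ¬ a ≤ n)]
    rw [h3, h4]
    push_cast
    ring
  rw [h1, h2]
  simp

/-- The right derivative at time `0`: it is finite if `{a, …, b}` is charged, or if it is empty and
gains no mass; otherwise it is `-∞`. -/
lemma IsClassicalSolution.exists_rightDeriv_zero (hp : IsClassicalSolution a b p)
    (haμ : a < μ) (hμb : μ < b) (h0 : p 0 ∈ Admissible μ) :
    ∃ d : EReal,
      Tendsto (fun s : ℝ =>
        (((modEntropy a b (weight₁ b μ) (weight₂ a b μ (p 0)) (p s) -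
          modEntropy a b (weight₁ b μ) (weight₂ a b μ (p 0)) (p 0)) / s : ℝ) : EReal))
        (𝓝[>] (0 : ℝ)) (𝓝 d) ∧
      d ≤ 0 ∧ (d = 0 ↔ IsTruncatedGeometric a b μ (p 0)) := by
  have hab : a < b := haμ.trans hμb
  have hV := h0.1
  have hg := rateG_pos hV haμ
  have hr := rateR_pos hV hμb
  set k₁ := weight₁ b μ with hk₁
  set k₂ := weight₂ a b μ (p 0) with hk₂
  by_cases hpos : ∀ n, a ≤ n → n ≤ b → 0 < p 0 n
  · have h1 := tendsto_slope_zero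
      (hp.hasDerivWithinAt_modEntropy (k₁ := k₁) (k₂ := k₂) hab h0 le_rfl hpos)
    obtain ⟨h2, h3⟩ := entropyRate_nonpos_and_eq_zero_iff hV haμ hμb
      (fun ha => hp.weight₂_add_log_pos haμ hμb h0 ha le_rfl) hpos
    refine ⟨(entropyRate a b k₁ k₂ (p 0) : ℝ), (continuous_coe_real_ereal.tendsto _).comp h1, ?_, ?_⟩
    · exact_mod_cast h2
    · rw [EReal.coe_eq_zero]; exact h3
  · have hnot : ¬ IsTruncatedGeometric a b μ (p 0) := fun h =>
      hpos fun n han hnb => h.pos hab.le han hnb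
    have hdecomp : ∀ᶠ s in 𝓝[>] (0 : ℝ), ∑ n ∈ Finset.range (b + 1),
        (siteEntropy a k₁ k₂ n (p s n) - siteEntropy a k₁ k₂ n (p 0 n)) / s =
        (modEntropy a b k₁ k₂ (p s) - modEntropy a b k₁ k₂ (p 0)) / s := by
      filter_upwards [eventually_mem_nhdsWithin] with s hs
      rw [modEntropy_eq (hp.mem_V hab h0 (le_of_lt hs)) hab, modEntropy_eq hV hab,
        ← Finset.sum_div, Finset.sum_sub_distrib]
      ring
    push Not at hpos
    obtain ⟨m, ham, hmb, hm⟩ := hpos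
    have hm0 : p 0 m = 0 := le_antisymm hm (hV.1 m)
    by_cases hgain : ∃ n, a ≤ n ∧ n ≤ b ∧ p 0 n = 0 ∧ 0 < L a b (p 0) n
    · obtain ⟨n, han, hnb, hn, hL⟩ := hgain
      refine ⟨⊥, ?_, bot_le, by simp [hnot]⟩
      rw [EReal.tendsto_coe_nhds_bot_iff]
      refine Tendsto.congr' hdecomp ?_
      have hsplit := fun s => Finset.add_sum_erase (Finset.range (b + 1))
        (fun n => (siteEntropy a k₁ k₂ n (p s n) - siteEntropy a k₁ k₂ n (p 0 n)) / s)
        (Finset.mem_range.2 (Nat.lt_succ_of_le hnb))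
      refine Tendsto.congr hsplit ?_
      choose C hC using fun n => hp.siteEntropy_slope_le (k₁ := k₁) (k₂ := k₂) hab h0 n
      refine tendsto_atBot_add_right_of_ge' _ (∑ k ∈ (Finset.range (b + 1)).erase n, C k)
        (hp.siteEntropy_slope_atBot han hn hL) ?_
      have hall : ∀ᶠ s in 𝓝[>] (0 : ℝ), ∀ k ∈ (Finset.range (b + 1)).erase n,
          (siteEntropy a k₁ k₂ k (p s k) - siteEntropy a k₁ k₂ k (p 0 k)) / s ≤ C k :=
        (eventually_all_finset _).2 fun k _ => hC k
      filter_upwards [hall] with s hs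
      exact Finset.sum_le_sum hs
    · push Not at hgain
      have hz := bulk_eq_zero hV.1 hg hr hgain ham hmb hm0
      have hlim : Tendsto (fun s => ∑ n ∈ Finset.range (b + 1),
          (siteEntropy a k₁ k₂ n (p s n) - siteEntropy a k₁ k₂ n (p 0 n)) / s) (𝓝[>] 0)
          (𝓝 (entropyRate a b k₁ k₂ (p 0))) := by
        refine tendsto_finsetSum _ fun n hn => ?_
        have hnb : n ≤ b := by rw [Finset.mem_range] at hn; omega
        by_cases han : a ≤ n
        · have hn0 := hz n (by omega) (by omega)
          have hL0 : L a b (p 0) n = 0 := by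
            rw [L, hn0, hz (n + 1) (by omega) (by omega)]
            have : 1 ≤ n ∧ n ≤ b → p 0 (n - 1) = 0 := fun h => hz _ (by omega) (by omega)
            split_ifs with h1 h2 h3 h4 <;> simp_all
          have h1 : Tendsto (fun s => p s n * Real.log (p s n) / s) (𝓝[>] 0) (𝓝 0) :=
            tendsto_mul_log_div (fun s hs => hp.nonneg s hs.le n) fun s hs =>
              hp.le_sq_of_neighbours_eq_zero hab h0 hn0 (hz (n + 1) (by omega) (by omega))
                (fun h => hz _ (by omega) (by omega)) hs
          have h2 := (tendsto_slope_zero (hp.ode 0 le_rfl n)).const_mul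
            (k₂ * ((a - n : ℕ) : ℝ) - k₁ * n - 1)
          have h3 := h1.add h2
          rw [hL0, mul_zero, add_zero] at h3
          rw [hL0, mul_zero]
          refine h3.congr fun s => ?_
          simp only [siteEntropy, if_pos han, hn0, zero_mul, mul_zero, add_zero, sub_zero]
          ring
        · have h1 := hasDerivAt_siteEntropy (k₁ := k₁) (k₂ := k₂) (p 0) fun h => absurd h han
          have h2 := h1.comp_hasDerivWithinAt 0 (hp.ode 0 le_rfl n)
          exact tendsto_slope_zero h2
      have hneg : entropyRate a b k₁ k₂ (p 0) < 0 := by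
        rw [entropyRate_of_bulk_eq_zero hab fun n h h' => hz n (by omega) h']
        have h1 : 0 < k₁ := weight₁_pos (by omega) hμb
        have h2 : 0 < k₂ := weight₂_pos hμb _
        have h3 := mul_pos (add_pos h1 h2) (mul_pos hg hr)
        linarith
      refine ⟨(entropyRate a b k₁ k₂ (p 0) : ℝ),
        (continuous_coe_real_ereal.tendsto _).comp (hlim.congr' hdecomp), ?_, ?_⟩
      · exact_mod_cast hneg.le
      · rw [EReal.coe_eq_zero]
        exact ⟨fun h => absurd h hneg.ne, fun h => absurd h hnot⟩

end EntropyAlongSolutions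

/-! ### Convergence to equilibrium -/

section Convergence

variable {a μ b : ℕ} {p : ℝ → ℕ → ℝ}

/-- Continuous observables for the product topology are uniformly continuous along a solution: the
components stay in the compact set `[0, 1] ^ ℕ` and are Lipschitz in time. -/
lemma IsClassicalSolution.uniformContinuousOn_comp (hp : IsClassicalSolution a b p)
    (hab : a < b) (h0 : p 0 ∈ Admissible μ) {φ : (ℕ → ℝ) → ℝ} (hφ : Continuous φ) :
    UniformContinuousOn (fun t => φ (p t)) (Ici 0) := by
  have hK : IsCompact (Set.univ.pi fun _ : ℕ => Icc (0 : ℝ) 1) :=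
    isCompact_univ_pi fun _ => isCompact_Icc
  have hφK := hK.uniformContinuousOn_of_continuous hφ.continuousOn
  have hpU : UniformContinuousOn p (Ici 0) := by
    rw [uniformContinuousOn_iff_restrict, uniformContinuous_pi]
    intro n
    have hlip : LipschitzOnWith 2 (fun t => p t n) (Ici 0) :=
      (convex_Ici 0).lipschitzOnWith_of_nnnorm_hasDerivWithin_le
        (fun t ht => hp.ode t ht n) fun t ht => by
          have := abs_L_le (a := a) (b := b) (hp.mem_V hab h0 ht) n
          rw [← NNReal.coe_le_coe, coe_nnnorm]
          exact this
    exact uniformContinuousOn_iff_restrict.1 hlip.uniformContinuousOn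
  refine hφK.comp hpU fun t ht n _ => ?_
  have hV := hp.mem_V hab h0 ht
  exact ⟨hV.1 n, le_one_of_mem hV n⟩

/-- The flux with the giver rate expressed by finitely many components, hence continuous for the
product topology. -/
lemma flux_eq_of_mem {q : ℕ → ℝ} (hq : q ∈ V μ) {n : ℕ} (han : a ≤ n) (hnb : n < b) :
    flux a b q n = (1 - ∑ l ∈ Finset.range (a + 1), q l) * q n -
      (∑ l ∈ Finset.range b, q l) * q (n + 1) := by
  have := sum_add_rateG (a := a) hq.2.1
  rw [flux_of_mem q han hnb, rateR]
  have e : rateG a q = 1 - ∑ l ∈ Finset.range (a + 1), q l := by linarith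
  rw [e]

/-- The bulk fluxes vanish asymptotically, because the modified entropy is bounded below. -/
lemma IsClassicalSolution.tendsto_sum_flux_sq (hp : IsClassicalSolution a b p)
    (haμ : a < μ) (hμb : μ < b) (h0 : p 0 ∈ Admissible μ) :
    Tendsto (fun t => ∑ n ∈ Finset.Ico a b, flux a b (p t) n ^ 2) atTop (𝓝 0) := by
  have hab : a < b := haμ.trans hμb
  have hV : ∀ t, 0 ≤ t → p t ∈ V μ := fun t ht => hp.mem_V hab h0 ht
  have hk₁ : 0 < weight₁ b μ := weight₁_pos (by omega) hμb
  have hk₂ : 0 < weight₂ a b μ (p 0) := weight₂_pos hμb _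
  refine tendsto_zero_of_dissipation
    (G := fun s => modEntropy a b (weight₁ b μ) (weight₂ a b μ (p 0)) (p s))
    (m := -∑ n ∈ Finset.Icc a b, (1 : ℝ)) (fun t ht => ?_)
    (fun t ht => hp.hasDerivAt_modEntropy haμ hμb h0 ht) (fun t ht => ?_)
    (fun t ht => Finset.sum_nonneg fun n _ => sq_nonneg _) ?_
  · -- Only the terms `x log x ≥ x - 1` can be negative.
    have hn := (hV t ht.le).1
    have h1 : 0 ≤ ∑ n ∈ Finset.range a, p t n := Finset.sum_nonneg fun n _ => hn n
    have h2 : -∑ n ∈ Finset.Icc a b, (1 : ℝ) ≤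
        ∑ n ∈ Finset.Icc a b, p t n * Real.log (p t n) := by
      rw [← Finset.sum_neg_distrib]
      refine Finset.sum_le_sum fun n _ => ?_
      rcases (hn n).eq_or_lt with h | h
      · rw [← h]; simp
      · have h3 := mul_le_mul_of_nonneg_left (Real.one_sub_inv_le_log_of_pos h) h.le
        rw [mul_sub, mul_one, mul_inv_cancel₀ h.ne'] at h3
        linarith
    have h3 : 0 ≤ ∑' n : ℕ, p t (n + (b + 1)) := tsum_nonneg fun n => hn _
    have h4 : 0 ≤ weight₁ b μ * ∑' n : ℕ, ((n + (b + 1) : ℕ) : ℝ) * p t (n + (b + 1)) :=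
      mul_nonneg hk₁.le (tsum_nonneg fun n => mul_nonneg (Nat.cast_nonneg _) (hn _))
    have h5 : 0 ≤ weight₂ a b μ (p 0) * ∑ n ∈ Finset.range a, ((a : ℝ) - n) * p t n := by
      refine mul_nonneg hk₂.le (Finset.sum_nonneg fun n hna => mul_nonneg ?_ (hn n))
      rw [sub_nonneg]
      exact_mod_cast (Finset.mem_range.1 hna).le
    simp only [modEntropy, entropy]
    linarith
  · have hq := hV t ht.le
    have hg := rateG_pos hq haμ
    have hr := rateR_pos hq hμb
    have h1 := entropyRate_le (k₂ := weight₂ a b μ (p 0)) hq haμ hμb hk₁.le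
      fun n han hnb => hp.pos haμ hμb h0 ht han hnb
    have h2 : 0 ≤ (weight₂ a b μ (p 0) + Real.log (rateG a (p t))) *
        (rateG a (p t) * ∑ n ∈ Finset.range a, p t n) := by
      rcases Nat.eq_zero_or_pos a with h | h
      · rw [h]; simp
      · exact mul_nonneg (hp.weight₂_add_log_pos haμ hμb h0 h ht.le).le
          (mul_nonneg hg.le (Finset.sum_nonneg fun n _ => hq.1 n))
    have h3 : 0 ≤ (weight₁ b μ + Real.log (rateR b (p t))) *
        (rateR b (p t) * tail (p t) (b + 1)) := by
      refine mul_nonneg ?_ (mul_nonneg hr.le (tail_nonneg hq.1 _))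
      have := Real.log_le_log (one_sub_div_pos hμb) (le_rateR hq (by omega))
      rw [weight₁]
      linarith
    linarith
  · refine (hp.uniformContinuousOn_comp hab h0 (φ := fun q => ∑ n ∈ Finset.Ico a b,
      ((1 - ∑ l ∈ Finset.range (a + 1), q l) * q n -
        (∑ l ∈ Finset.range b, q l) * q (n + 1)) ^ 2) (by fun_prop)).congr fun t ht => ?_
    refine Finset.sum_congr rfl fun n hn => ?_
    rw [flux_eq_of_mem (hV t ht) (Finset.mem_Ico.1 hn).1 (Finset.mem_Ico.1 hn).2]

/-- The mass above `b` vanishes asymptotically, because `∑_{n > b} n p_n` decreases at a rate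
proportional to it. -/
lemma IsClassicalSolution.tendsto_mass_above (hp : IsClassicalSolution a b p)
    (haμ : a < μ) (hμb : μ < b) (h0 : p 0 ∈ Admissible μ) :
    Tendsto (fun t => 1 - ∑ n ∈ Finset.range (b + 1), p t n) atTop (𝓝 0) := by
  have hab : a < b := haμ.trans hμb
  have hV : ∀ t, 0 ≤ t → p t ∈ V μ := fun t ht => hp.mem_V hab h0 ht
  have hc := one_sub_div_pos hμb
  have htail : ∀ t, 0 ≤ t → 1 - ∑ n ∈ Finset.range (b + 1), p t n = tail (p t) (b + 1) := by
    intro t ht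
    have := sum_range_add_tail (hV t ht).2.1.summable (b + 1)
    rw [(hV t ht).2.1.tsum_eq] at this
    linarith
  have key : Tendsto (fun t => (1 - (μ : ℝ) / b) * (1 - ∑ n ∈ Finset.range (b + 1), p t n))
      atTop (𝓝 0) := by
    refine tendsto_zero_of_dissipation (m := 0)
      (G := fun s => (μ : ℝ) - ∑ n ∈ Finset.range (b + 1), (n : ℝ) * p s n)
      (fun t ht => ?_)
      (fun t ht => ((hp.hasDerivWithinAt_mean hab h0.1.2.1 le_rfl ht.le).hasDerivAt
        (Ici_mem_nhds ht)).const_sub (μ : ℝ))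
      (fun t ht => ?_) (fun t ht => ?_) ?_
    · exact sub_nonneg.2 (sum_le_hasSum _
        (fun n _ => mul_nonneg n.cast_nonneg ((hV t ht.le).1 n)) (hV t ht.le).2.2)
    · rw [htail t ht.le]
      have h1 := le_rateR (hV t ht.le) (b := b) (by omega)
      have h2 := tail_nonneg (hV t ht.le).1 (b + 1)
      have h3 : 0 ≤ (b : ℝ) * p t (b + 1) := mul_nonneg b.cast_nonneg ((hV t ht.le).1 _)
      have h4 := mul_le_mul_of_nonneg_right h1 h2
      have h5 := mul_nonneg (hc.le.trans h1) h3
      linarith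
    · rw [htail t ht.le]
      exact mul_nonneg hc.le (tail_nonneg (hV t ht.le).1 _)
    · exact hp.uniformContinuousOn_comp hab h0
        (φ := fun q => (1 - (μ : ℝ) / b) * (1 - ∑ n ∈ Finset.range (b + 1), q n)) (by fun_prop)
  have := key.const_mul (1 - (μ : ℝ) / b)⁻¹
  rw [mul_zero] at this
  exact this.congr fun t => inv_mul_cancel_left₀ hc.ne' _

/-- The mass below `a` vanishes asymptotically, because `∑_{n < a} (a - n) p_n` decreases at a rate
proportional to it. -/
lemma IsClassicalSolution.tendsto_mass_below (hp : IsClassicalSolution a b p)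
    (haμ : a < μ) (hμb : μ < b) (h0 : p 0 ∈ Admissible μ) :
    Tendsto (fun t => ∑ n ∈ Finset.range a, p t n) atTop (𝓝 0) := by
  have hab : a < b := haμ.trans hμb
  have hV : ∀ t, 0 ≤ t → p t ∈ V μ := fun t ht => hp.mem_V hab h0 ht
  rcases Nat.eq_zero_or_pos a with ha | ha
  · subst ha; simp
  obtain ⟨m, rfl⟩ : ∃ m, a = m + 1 := ⟨a - 1, by omega⟩
  set c := Real.exp (-weight₂ (m + 1) b μ (p 0)) with hc
  have hc0 : 0 < c := Real.exp_pos _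
  have hcg : ∀ t, 0 ≤ t → c ≤ rateG (m + 1) (p t) := by
    intro t ht
    have h1 := hp.weight₂_add_log_pos haμ hμb h0 ha ht
    rw [hc, ← Real.le_log_iff_exp_le (rateG_pos (hV t ht) haμ)]
    linarith
  have hS0 : ∀ t, 0 ≤ t → 0 ≤ ∑ n ∈ Finset.range (m + 1), p t n := fun t ht =>
    Finset.sum_nonneg fun n _ => (hV t ht).1 n
  have hrate : ∀ t, ∑ n ∈ Finset.range (m + 1), (((m + 1 : ℕ) : ℝ) - n) * L (m + 1) b (p t) n =
      -(rateG (m + 1) (p t) * ∑ n ∈ Finset.range (m + 1), p t n) := by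
    intro t
    have e := sum_mul_L (m + 1) b (p t) (fun n => ((m + 1 : ℕ) : ℝ) - n) m
    rw [e, flux_of_lt _ (by omega) hab, Finset.sum_congr rfl fun n hn =>
      congrArg _ (flux_of_lt (p t) (by rw [Finset.mem_range] at hn; omega) hab),
      Finset.sum_range_succ, mul_add, Finset.mul_sum, neg_add, ← Finset.sum_neg_distrib]
    push_cast
    rw [sub_eq_add_neg]
    congr 1
    · exact Finset.sum_congr rfl fun n _ => by ring
    · ring
  have key : Tendsto (fun t => c * ∑ n ∈ Finset.range (m + 1), p t n) atTop (𝓝 0) := by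
    refine tendsto_zero_of_dissipation (m := 0)
      (G := fun s => ∑ n ∈ Finset.range (m + 1), (((m + 1 : ℕ) : ℝ) - n) * p s n)
      (fun t ht => Finset.sum_nonneg fun n hn => mul_nonneg ?_ ((hV t ht.le).1 n))
      (fun t ht => (hp.hasDerivWithinAt_sum _ _ ht.le).hasDerivAt (Ici_mem_nhds ht))
      (fun t ht => ?_) (fun t ht => mul_nonneg hc0.le (hS0 t ht.le)) ?_
    · rw [sub_nonneg]
      exact_mod_cast (Finset.mem_range.1 hn).le
    · rw [hrate, neg_le_neg_iff]
      exact mul_le_mul_of_nonneg_right (hcg t ht.le) (hS0 t ht.le)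
    · exact hp.uniformContinuousOn_comp hab h0
        (φ := fun q => c * ∑ n ∈ Finset.range (m + 1), q n) (by fun_prop)
  have := key.const_mul c⁻¹
  rw [mul_zero] at this
  exact this.congr fun t => inv_mul_cancel_left₀ hc0.ne' _

/-- The geometric dominating sequence is summable, also against the weight `n`. -/
lemma summable_geometric_bound (M : ℝ) :
    (Summable fun n : ℕ => M * (1 / 2 : ℝ) ^ n) ∧
      Summable fun n : ℕ => (n : ℝ) * (M * (1 / 2 : ℝ) ^ n) := by
  refine ⟨summable_geometric_two.mul_left M, ?_⟩
  have h := (summable_pow_mul_geometric_of_norm_lt_one 1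
    (by norm_num : ‖(1 / 2 : ℝ)‖ < 1)).mul_left M
  refine h.congr fun n => ?_
  rw [pow_one]; ring

/-- Componentwise convergence: by compactness of `[0, 1] ^ ℕ` it suffices to identify the limits
along ultrafilters, which lie in `V μ` by dominated convergence and have no mass outside
`{a, …, b}` and no flux inside. -/
lemma IsClassicalSolution.tendsto_apply (hp : IsClassicalSolution a b p)
    (haμ : a < μ) (hμb : μ < b) (h0 : p 0 ∈ Admissible μ) {π : ℕ → ℝ}
    (hπ : IsTruncatedGeometric a b μ π) (n : ℕ) :
    Tendsto (fun t => p t n) atTop (𝓝 (π n)) := by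
  have hab : a < b := haμ.trans hμb
  have hV : ∀ t, 0 ≤ t → p t ∈ V μ := fun t ht => hp.mem_V hab h0 ht
  suffices h : Tendsto p atTop (𝓝 π) from (continuous_apply n).continuousAt.tendsto.comp h
  rw [tendsto_iff_ultrafilter]
  intro U hU
  have hge : ∀ᶠ t in (U : Filter ℝ), 0 ≤ t := hU (eventually_ge_atTop 0)
  have hK : IsCompact (Set.univ.pi fun _ : ℕ => Icc (0 : ℝ) 1) :=
    isCompact_univ_pi fun _ => isCompact_Icc
  obtain ⟨q, -, hq⟩ := hK.ultrafilter_le_nhds (U.map p) (by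
    rw [le_principal_iff]
    change ∀ᶠ t in (U : Filter ℝ), p t ∈ Set.univ.pi fun _ : ℕ => Icc (0 : ℝ) 1
    filter_upwards [hge] with t ht k _
    exact ⟨(hV t ht).1 k, le_one_of_mem (hV t ht) k⟩)
  have hlim : Tendsto p U (𝓝 q) := hq
  have hlim' : ∀ k, Tendsto (fun t => p t k) U (𝓝 (q k)) := fun k =>
    (continuous_apply k).continuousAt.tendsto.comp hlim
  have hq0 : ∀ k, 0 ≤ q k := fun k =>
    ge_of_tendsto (hlim' k) (hge.mono fun t ht => (hV t ht).1 k)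
  set M := 2 ^ b + ∑' n : ℕ, (2 : ℝ) ^ n * p 0 n with hM
  obtain ⟨hs1, hs2⟩ := summable_geometric_bound M
  have hdom : ∀ᶠ t in (U : Filter ℝ), ∀ k, p t k ≤ M * (1 / 2) ^ k :=
    hge.mono fun t ht k => hp.le_geometric hab h0 ht k
  have hqdom : ∀ k, q k ≤ M * (1 / 2) ^ k := fun k =>
    le_of_tendsto (hlim' k) (hdom.mono fun t ht => ht k)
  have hqs : Summable q := Summable.of_nonneg_of_le hq0 hqdom hs1
  have hqs' : Summable fun k : ℕ => (k : ℝ) * q k :=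
    Summable.of_nonneg_of_le (fun k => mul_nonneg k.cast_nonneg (hq0 k))
      (fun k => mul_le_mul_of_nonneg_left (hqdom k) k.cast_nonneg) hs2
  have hmass : ∑' k, q k = 1 := by
    have h1 := tendsto_tsum_of_dominated_convergence hs1 hlim' (by
      filter_upwards [hge, hdom] with t ht hd k
      rw [Real.norm_of_nonneg ((hV t ht).1 k)]
      exact hd k)
    refine tendsto_nhds_unique h1 (tendsto_const_nhds.congr' ?_)
    filter_upwards [hge] with t ht
    exact (hV t ht).2.1.tsum_eq.symm
  have hmean : ∑' k : ℕ, (k : ℝ) * q k = μ := by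
    have h1 := tendsto_tsum_of_dominated_convergence hs2
      (fun k : ℕ => (hlim' k).const_mul (k : ℝ)) (by
      filter_upwards [hge, hdom] with t ht hd k
      rw [Real.norm_of_nonneg (mul_nonneg k.cast_nonneg ((hV t ht).1 k))]
      exact mul_le_mul_of_nonneg_left (hd k) k.cast_nonneg)
    refine tendsto_nhds_unique h1 (tendsto_const_nhds.congr' ?_)
    filter_upwards [hge] with t ht
    exact (hV t ht).2.2.tsum_eq.symm
  have hqV : q ∈ V μ := ⟨hq0, hmass ▸ hqs.hasSum, hmean ▸ hqs'.hasSum⟩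
  -- A continuous observable that vanishes asymptotically vanishes at `q`.
  have hobs : ∀ {φ : (ℕ → ℝ) → ℝ}, Continuous φ →
      Tendsto (fun t => φ (p t)) atTop (𝓝 0) → φ q = 0 := fun hφ h =>
    tendsto_nhds_unique (hφ.continuousAt.tendsto.comp hlim) (h.mono_left hU)
  have hlow : ∑ k ∈ Finset.range a, q k = 0 :=
    hobs (φ := fun q => ∑ k ∈ Finset.range a, q k) (by fun_prop)
      (hp.tendsto_mass_below haμ hμb h0)
  have hhigh : 1 - ∑ k ∈ Finset.range (b + 1), q k = 0 :=
    hobs (φ := fun q => 1 - ∑ k ∈ Finset.range (b + 1), q k) (by fun_prop)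
      (hp.tendsto_mass_above haμ hμb h0)
  have hflux : ∑ k ∈ Finset.Ico a b, ((1 - ∑ l ∈ Finset.range (a + 1), q l) * q k -
      (∑ l ∈ Finset.range b, q l) * q (k + 1)) ^ 2 = 0 := by
    refine hobs (φ := fun q => ∑ k ∈ Finset.Ico a b,
      ((1 - ∑ l ∈ Finset.range (a + 1), q l) * q k -
        (∑ l ∈ Finset.range b, q l) * q (k + 1)) ^ 2) (by fun_prop) ?_
    refine (hp.tendsto_sum_flux_sq haμ hμb h0).congr' ?_
    filter_upwards [eventually_ge_atTop 0] with t ht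
    refine Finset.sum_congr rfl fun k hk => ?_
    rw [flux_eq_of_mem (hV t ht) (Finset.mem_Ico.1 hk).1 (Finset.mem_Ico.1 hk).2]
  have htail : tail q (b + 1) = 0 := by
    have := sum_range_add_tail hqs (b + 1)
    linarith
  have hgeo : IsTruncatedGeometric a b μ q := by
    refine isTruncatedGeometric_of_flux_eq_zero hqV haμ hμb (fun k hk => ?_) (fun k hk => ?_)
      fun k hk => ?_
    · rw [flux_eq_of_mem hqV (Finset.mem_Ico.1 hk).1 (Finset.mem_Ico.1 hk).2]
      exact pow_eq_zero_iff two_ne_zero |>.1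
        ((Finset.sum_eq_zero_iff_of_nonneg fun k _ => sq_nonneg _).1 hflux k hk)
    · exact (Finset.sum_eq_zero_iff_of_nonneg fun k _ => hq0 k).1 hlow k (Finset.mem_range.2 hk)
    · exact le_antisymm (htail ▸ le_tail hqs hq0 hk) (hq0 k)
  rw [hπ.unique haμ hμb hgeo]
  exact hlim

/-- Convergence in `ℓ¹`. -/
lemma IsClassicalSolution.tendsto_tsum_abs_sub (hp : IsClassicalSolution a b p)
    (haμ : a < μ) (hμb : μ < b) (h0 : p 0 ∈ Admissible μ) {π : ℕ → ℝ}
    (hπ : IsTruncatedGeometric a b μ π) :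
    Tendsto (fun t => ∑' n, |p t n - π n|) atTop (𝓝 0) := by
  have hab : a < b := haμ.trans hμb
  have hsum := ((summable_geometric_bound (2 ^ b + ∑' n : ℕ, (2 : ℝ) ^ n * p 0 n)).1).add
    hπ.1.2.1.summable
  have h := tendsto_tsum_of_dominated_convergence (𝓕 := atTop) hsum
    (f := fun t n => |p t n - π n|) (g := fun _ => 0)
    (fun n => by
      simpa using ((hp.tendsto_apply haμ hμb h0 hπ n).sub_const (π n)).abs) (by
      filter_upwards [eventually_ge_atTop 0] with t ht n
      rw [Real.norm_eq_abs, abs_abs]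
      refine (abs_sub _ _).trans ?_
      rw [abs_of_nonneg (hp.nonneg t ht n), abs_of_nonneg (hπ.1.1 n)]
      exact add_le_add_left (hp.le_geometric hab h0 ht n) _)
  simpa using h

lemma memℓp_of_mem_V {q : ℕ → ℝ} (hq : q ∈ V μ) {r : ℝ≥0∞} (hr : 1 ≤ r) : Memℓp q r := by
  refine Memℓp.of_exponent_ge (memℓp_gen ?_) hr
  refine hq.2.1.summable.congr fun n => ?_
  rw [ENNReal.toReal_one, Real.rpow_one, Real.norm_of_nonneg (hq.1 n)]

/-- Convergence in `ℓ¹` of sequences bounded by `1` implies convergence in `ℓ^r`. -/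
lemma tendsto_norm_sub_lp {r : ℝ≥0∞} (hr : 1 < r) (hr' : r < ⊤)
    {P : ℝ → lp (fun _ : ℕ => ℝ) r} {Q : lp (fun _ : ℕ => ℝ) r}
    (hP : ∀ t, 0 ≤ t → (P t : ℕ → ℝ) ∈ V μ) (hQ : (Q : ℕ → ℝ) ∈ V μ)
    (h : Tendsto (fun t => ∑' n, |P t n - Q n|) atTop (𝓝 0)) :
    Tendsto (fun t => ‖P t - Q‖) atTop (𝓝 0) := by
  have hr1 : 1 < r.toReal := by
    rw [← ENNReal.toReal_one]
    exact (ENNReal.toReal_lt_toReal ENNReal.one_ne_top hr'.ne).2 hr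
  have hr0 : 0 < r.toReal := by linarith
  have hle : ∀ t, 0 ≤ t → ‖P t - Q‖ ^ r.toReal ≤ ∑' n, |P t n - Q n| := by
    intro t ht
    rw [lp.norm_rpow_eq_tsum hr0]
    have hs : Summable fun n => |P t n - Q n| :=
      ((hP t ht).2.1.summable.sub hQ.2.1.summable).abs
    have hpt : ∀ n, ‖(P t - Q : lp (fun _ : ℕ => ℝ) r) n‖ ^ r.toReal ≤ |P t n - Q n| := by
      intro n
      rw [lp.coeFn_sub, Pi.sub_apply, Real.norm_eq_abs]
      have h1 : |P t n - Q n| ≤ 1 := by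
        have h2 := (hP t ht).1 n
        have h3 := le_one_of_mem (hP t ht) n
        have h4 := hQ.1 n
        have h5 := le_one_of_mem hQ n
        exact abs_le.2 ⟨by linarith, by linarith⟩
      calc |P t n - Q n| ^ r.toReal ≤ |P t n - Q n| ^ (1 : ℝ) :=
            Real.rpow_le_rpow_of_exponent_ge' (abs_nonneg _) h1 zero_le_one hr1.le
        _ = _ := Real.rpow_one _
    exact Summable.tsum_le_tsum hpt
      (Summable.of_nonneg_of_le (fun n => by positivity) hpt hs) hs
  have hpow : Tendsto (fun t => ‖P t - Q‖ ^ r.toReal) atTop (𝓝 0) :=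
    squeeze_zero' (Eventually.of_forall fun t => Real.rpow_nonneg (lp.norm_nonneg' _) _)
      ((eventually_ge_atTop 0).mono hle) h
  have := hpow.rpow_const (p := r.toReal⁻¹) (Or.inr (inv_nonneg.2 hr0.le))
  rw [Real.zero_rpow (inv_ne_zero hr0.ne')] at this
  exact this.congr fun t => Real.rpow_rpow_inv (lp.norm_nonneg' _) hr0.ne'

end Convergence

end ThreeClassBDY

theorem theorem2 (a μ b : ℕ) (haμ : a < μ) (hμb : μ < b) :
    ∃ pstar : ℕ → ℝ,
      -- the equilibrium is well defined
      ThreeClassBDY.IsTruncatedGeometric a b μ pstar ∧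
      (∀ π : ℕ → ℝ, ThreeClassBDY.IsTruncatedGeometric a b μ π → π = pstar) ∧
      ∀ p : ℝ → ℕ → ℝ, ThreeClassBDY.IsClassicalSolution a b p →
        p 0 ∈ ThreeClassBDY.Admissible μ →
        ∀ k₁ k₂ : ℝ, k₁ = ThreeClassBDY.weight₁ b μ →
          k₂ = ThreeClassBDY.weight₂ a b μ (p 0) →
          0 < k₁ ∧ 0 < k₂ ∧
          -- all the series in the modified entropy converge
          (∀ t : ℝ, 0 ≤ t → p t ∈ ThreeClassBDY.V μ) ∧
          -- the modified entropy is non-increasing on `[0, ∞)`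
          AntitoneOn (fun t => ThreeClassBDY.modEntropy a b k₁ k₂ (p t)) (Ici 0) ∧
          -- dissipation at positive times
          (∀ t : ℝ, 0 < t → ∃ d : ℝ,
            HasDerivAt (fun s => ThreeClassBDY.modEntropy a b k₁ k₂ (p s)) d t ∧
              d ≤ 0 ∧ (d = 0 ↔ p t = pstar)) ∧
          -- dissipation at time `0`: the right derivative exists in `[-∞, 0]`
          (∃ d : EReal,
            Tendsto (fun s : ℝ =>
              (((ThreeClassBDY.modEntropy a b k₁ k₂ (p s) -
                ThreeClassBDY.modEntropy a b k₁ k₂ (p 0)) / s : ℝ) : EReal))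
              (𝓝[>] (0 : ℝ)) (𝓝 d) ∧
              d ≤ 0 ∧ (d = 0 ↔ p 0 = pstar)) ∧
          -- strong convergence in every `ℓ^q`, `1 < q < ∞`
          (∀ q : ℝ≥0∞, 1 < q → q < ⊤ →
            ∃ (P : ℝ → lp (fun _ : ℕ => ℝ) q) (Q : lp (fun _ : ℕ => ℝ) q),
              (∀ t : ℝ, 0 ≤ t → ∀ n : ℕ, P t n = p t n) ∧
              (∀ n : ℕ, Q n = pstar n) ∧
              Tendsto (fun t => ‖P t - Q‖) atTop (𝓝 0)) := by
  have hab : a < b := haμ.trans hμb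
  obtain ⟨π, hπ⟩ := ThreeClassBDY.exists_isTruncatedGeometric haμ hμb
  have hiff : ∀ q : ℕ → ℝ, ThreeClassBDY.IsTruncatedGeometric a b μ q ↔ q = π := fun q =>
    ⟨fun h => h.unique haμ hμb hπ, fun h => h ▸ hπ⟩
  refine ⟨π, hπ, fun q hq => (hiff q).1 hq, ?_⟩
  rintro p hp h0 _ _ rfl rfl
  have hV : ∀ t, 0 ≤ t → p t ∈ ThreeClassBDY.V μ := fun t ht => hp.mem_V hab h0 ht
  have hrate := fun (t : ℝ) (ht : 0 < t) =>
    ThreeClassBDY.entropyRate_nonpos_and_eq_zero_iff (hV t ht.le) haμ hμb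
      (fun ha => hp.weight₂_add_log_pos haμ hμb h0 ha ht.le)
      fun n han hnb => hp.pos haμ hμb h0 ht han hnb
  refine ⟨ThreeClassBDY.weight₁_pos (by omega) hμb, ThreeClassBDY.weight₂_pos hμb _, hV, ?_, ?_,
    ?_, ?_⟩
  · refine antitoneOn_of_hasDerivWithinAt_nonpos (convex_Ici 0)
      (hp.continuousOn_modEntropy hab h0)
      (f' := fun t => ThreeClassBDY.entropyRate a b (ThreeClassBDY.weight₁ b μ)
        (ThreeClassBDY.weight₂ a b μ (p 0)) (p t)) (fun t ht => ?_) fun t ht => ?_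
    · rw [interior_Ici] at ht
      exact (hp.hasDerivAt_modEntropy haμ hμb h0 ht).hasDerivWithinAt
    · rw [interior_Ici] at ht
      exact (hrate t ht).1
  · exact fun t ht => ⟨_, hp.hasDerivAt_modEntropy haμ hμb h0 ht, (hrate t ht).1,
      (hrate t ht).2.trans (hiff _)⟩
  · obtain ⟨d, h1, h2, h3⟩ := hp.exists_rightDeriv_zero haμ hμb h0
    exact ⟨d, h1, h2, h3.trans (hiff _)⟩
  · intro r hr hr'
    -- At negative times, where nothing is known, the curve takes the value `p 0`.
    have hmax : ∀ t : ℝ, p (max t 0) ∈ ThreeClassBDY.V μ := fun t => hV _ (le_max_right _ _)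
    refine ⟨fun t => ⟨p (max t 0), ThreeClassBDY.memℓp_of_mem_V (hmax t) hr.le⟩,
      ⟨π, ThreeClassBDY.memℓp_of_mem_V hπ.1 hr.le⟩, fun t ht n => ?_, fun n => rfl, ?_⟩
    · change p (max t 0) n = p t n
      rw [max_eq_left ht]
    · refine ThreeClassBDY.tendsto_norm_sub_lp hr hr' (fun t _ => hmax t) hπ.1 ?_
      refine (hp.tendsto_tsum_abs_sub haμ hμb h0 hπ).congr' ?_
      filter_upwards [eventually_ge_atTop 0] with t ht
      change _ = ∑' n, |p (max t 0) n - π n|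
      rw [max_eq_left ht]
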